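/- **Setting.** Work in the internal language of a Grothendieck topos $\mathcal E=\mathrm{Sh}(\mathcal C,J)$ with a commutative $\mathbb Q$-algebra object $R$ satisfying the general Kock–Lawvere axiom: for every Weil algebra $W$ over $\mathbb Q$ (finite-dimensional commutative $\mathbb Q$-algebra with an augmentation $W\to\mathbb Q$ whose kernel is nilpotent) the canonical map $R\otimes_{\mathbb Q} W\to R^{\mathrm{Spec}_R W}$ is invertible, where $\mathrm{Spec}_R W$ is the object of $\mathbb Q$-algebra maps $W\to R$. Let $D(n)=\{d\in R^n\mid d_id_j=0 \text{ for all } i,j\}$. In any object $X$ write $x\sim y$ ($x$ and $y$ are *neighbours*) if, for some $m$, there are a map $f:D(m)\to X$ and $d\in D(m)$ with $f(0)=x$, $f(d)=y$; in $R^n$ (and hence in charts) this says $y-x\in D(n)$. A subset is *formally open* if it is closed under $\sim$. A *(formal) manifold* is an object $M$ in which each point lies in a formally open subset that is isomorphic to a formally open subset of some $R^n$; on a manifold $\sim$ is reflexive and symmetric. Write $x\sim_\infty y$ if there is a finite path $x\sim y_1\sim\dots\sim y$; the *$\infty$-monad* of $x_0\in M$ is $\mathfrak M_\infty(x_0)=\{y\mid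 x_0\sim_\infty y\}$. An *affine connection* on $M$ is a map $(x,y,z)\mapsto\lambda(x,y,z)\in M$, defined for $y\sim x\sim z$, such that $\lambda(x,y,z)\sim y$, $\lambda(x,y,z)\sim z$, $\lambda(x,x,z)=z$, $\lambda(x,y,x)=y$ and $\lambda(y,x,\lambda(x,y,z))=z$. It is *symmetric* if $\lambda(x,y,z)=\lambda(x,z,y)$, and *flat* if $\lambda(y,z,\lambda(x,y,t))=\lambda(x,z,t)$ whenever $x,y,z$ are mutual neighbours and $t\sim x$. An *affine space over $\mathbb Z$* is a set with operations $(x_1,\dots,x_n)\mapsto\sum a_ix_i$, one for each tuple of integers $a_i$ with $\sum a_i=1$, such that the tuple $(0,\dots,1,\dots,0)$ with $1$ in position $i$ gives $x_i$, and $\sum_i a_i\bigl(\sum_j b_{ij}x_j\bigr)=\sum_j\bigl(\sum_i a_ib_{ij}\bigr)x_j$. **Theorem.** Let $M$ be a manifold with a symmetric and flat affine connection $\lambda$. Then every $\infty$-monad $\mathfrak M_\infty(x_0)$ of $M$ (for every generalized point $x_0$ of $M$, at any stage) carries a unique structure of affine space over $\mathbb Z$ such that $$\lambda(x,y,z)=y-x+z\qquad\text{for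 all } x,y,z\in\mathfrak M_\infty(x_0)\text{ with } y\sim x\sim z .$$ -/

import Mathlib

open CategoryTheory Opposite
open scoped TensorProduct

/-! Everything is interpreted in the Grothendieck topos of sheaves on a site `(C, J)`, through
generalized elements: a point of an object `X` *at stage* `c` is an element of `X.obj (op c)`,
a map out of a (partially defined) object is a family of functions that is natural in the stage,
and an internal `∃` means existence after restriction along some covering sieve. -/

universe v u w w'

namespace SDG

variable {C : Type u} [Category.{v} C]

/-- Restriction of a generalized point along `g : b ⟶ c`. -/
abbrev res (X : Cᵒᵖ ⥤ Type w') {b c : C} (g : b ⟶ c) (x : X.obj (op c)) : X.obj (op b) :=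
  X.map g.op x

/-- Restriction of a generalized scalar along `g : b ⟶ c`, as an algebra homomorphism. -/
abbrev resR (R : Cᵒᵖ ⥤ CommAlgCat.{w} ℚ) {b c : C} (g : b ⟶ c) :
    R.obj (op c) →ₐ[ℚ] R.obj (op b) :=
  (R.map g.op).hom

/-- Weil algebras over `ℚ`: finite dimensional commutative `ℚ`-algebras with an augmentation to
`ℚ` whose kernel is a nilpotent ideal. -/
def IsWeilAlgebra (W : Type) [CommRing W] [Algebra ℚ W] : Prop :=
  Module.Finite ℚ W ∧ ∃ π : W →ₐ[ℚ] ℚ, IsNilpotent (RingHom.ker π)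

/-- The general Kock–Lawvere axiom: for each Weil algebra `W`, the canonical map
`R ⊗ W ⟶ R ^ (Spec_R W)` is invertible, where the infinitesimal object `Spec_R W` has the algebra
homomorphisms `W →ₐ[ℚ] R.obj (op b)` as its points at stage `b`. A point of the exponential at
stage `c` is a function of the points of `Spec_R W` at all stages over `c`, natural in the
stage. -/
def KockLawvere (R : Cᵒᵖ ⥤ CommAlgCat.{w} ℚ) : Prop :=
  ∀ (W : Type) [CommRing W] [Algebra ℚ W], IsWeilAlgebra W →
    ∀ (c : C) (f : ∀ ⦃b : C⦄, (b ⟶ c) → (W →ₐ[ℚ] R.obj (op b)) → R.obj (op b)),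
      (∀ ⦃a b : C⦄ (h : a ⟶ b) (g : b ⟶ c) (s : W →ₐ[ℚ] R.obj (op b)),
        f (h ≫ g) ((resR R h).comp s) = resR R h (f g s)) →
      ∃! t : R.obj (op c) ⊗[ℚ] W, ∀ ⦃b : C⦄ (g : b ⟶ c) (s : W →ₐ[ℚ] R.obj (op b)),
        f g s = Algebra.TensorProduct.productMap (resR R g) s t

/-- The first order neighbour relation of the coordinate space `Rⁿ`, over a ring `A` of scalars:
`v - u` lies in `D(n) = {d | ∀ i j, d i * d j = 0}`. -/
def CoordNbr {A : Type w} [CommRing A] {n : ℕ} (u v : Fin n → A) : Prop :=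
  ∀ i j, (v i - u i) * (v j - u j) = 0

/-- A figure `D(m) ⟶ X` at stage `c`: a map into `X` from the object `D(m)` of first order
neighbours of `0 ∈ Rᵐ`, defined at all stages over `c`. -/
structure Figure (R : Cᵒᵖ ⥤ CommAlgCat.{w} ℚ) (X : Cᵒᵖ ⥤ Type w') (m : ℕ) (c : C) where
  toFun : ∀ ⦃b : C⦄, (b ⟶ c) → {d : Fin m → R.obj (op b) // CoordNbr 0 d} → X.obj (op b)
  natural : ∀ ⦃a b : C⦄ (h : a ⟶ b) (g : b ⟶ c)
    (d : {d : Fin m → R.obj (op b) // CoordNbr 0 d})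
    (d' : {d : Fin m → R.obj (op a) // CoordNbr 0 d}),
    (∀ i, d'.1 i = resR R h (d.1 i)) → toFun (h ≫ g) d' = res X h (toFun g d)

variable (J : GrothendieckTopology C) (R : Cᵒᵖ ⥤ CommAlgCat.{w} ℚ)

/-- The first order neighbour relation `x ∼ y`: locally, `y` is the value at some `d ∈ D(m)` of
a map `D(m) ⟶ X` which sends `0` to `x`. For formal manifolds it says that, in a chart around
`x`, the coordinate vectors of `x` and `y` differ by an element of `D(n)`. -/
def Nbr (X : Cᵒᵖ ⥤ Type w') {c : C} (x y : X.obj (op c)) : Prop :=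
  ∃ S ∈ J c, ∀ ⦃b : C⦄ (g : b ⟶ c), S g →
    ∃ (m : ℕ) (f : Figure R X m b) (o d : {d : Fin m → R.obj (op b) // CoordNbr 0 d}),
      o.1 = 0 ∧ f.toFun (𝟙 b) o = res X g x ∧ f.toFun (𝟙 b) d = res X g y

theorem Nbr.restrict {X : Cᵒᵖ ⥤ Type w'} {c : C} {x y : X.obj (op c)} (hxy : Nbr J R X x y)
    {b : C} (g : b ⟶ c) : Nbr J R X (res X g x) (res X g y) := by
  obtain ⟨S, hS, H⟩ := hxy
  refine ⟨S.pullback g, J.pullback_stable g hS, fun a h hh => ?_⟩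
  obtain ⟨m, f, o, d, ho, h0, h1⟩ := H (h ≫ g) hh
  refine ⟨m, f, o, d, ho, ?_, ?_⟩
  · simpa [res] using h0
  · simpa [res] using h1

/-- A chart of dimension `n` on `M` at stage `c`: a formally open subset of `Rⁿ` (a subsheaf closed
under the neighbour relation), and an injective map from it to `M` whose image is formally open in
`M`. The subset and the map are defined at all stages over `c`. -/
structure Chart (M : Cᵒᵖ ⥤ Type w') (n : ℕ) (c : C) where
  dom : ∀ ⦃b : C⦄, (b ⟶ c) → Set (Fin n → R.obj (op b))
  dom_res : ∀ ⦃a b : C⦄ (h : a ⟶ b) (g : b ⟶ c) (p : Fin n → R.obj (op b)),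
    p ∈ dom g → (fun i => resR R h (p i)) ∈ dom (h ≫ g)
  dom_local : ∀ ⦃b : C⦄ (g : b ⟶ c) (p : Fin n → R.obj (op b)),
    (∃ S ∈ J b, ∀ ⦃a : C⦄ (h : a ⟶ b), S h → (fun i => resR R h (p i)) ∈ dom (h ≫ g)) → p ∈ dom g
  dom_open : ∀ ⦃b : C⦄ (g : b ⟶ c) (p q : Fin n → R.obj (op b)),
    p ∈ dom g → CoordNbr p q → q ∈ dom g
  map : ∀ ⦃b : C⦄ (g : b ⟶ c), dom g → M.obj (op b)
  map_natural : ∀ ⦃a b : C⦄ (h : a ⟶ b) (g : b ⟶ c) (p : dom g),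
    map (h ≫ g) ⟨fun i => resR R h (p.1 i), dom_res h g p.1 p.2⟩ = res M h (map g p)
  map_injective : ∀ ⦃b : C⦄ (g : b ⟶ c), Function.Injective (map g)
  range_open : ∀ ⦃b : C⦄ (g : b ⟶ c) (x y : M.obj (op b)),
    x ∈ Set.range (map g) → Nbr J R M x y → y ∈ Set.range (map g)

/-- Formal manifolds: locally, every point lies in a chart. -/
def IsFormalManifold (M : Cᵒᵖ ⥤ Type w') : Prop :=
  ∀ ⦃c : C⦄ (x : M.obj (op c)), ∃ S ∈ J c, ∀ ⦃b : C⦄ (g : b ⟶ c), S g →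
    ∃ (n : ℕ) (χ : Chart J R M n b), res M g x ∈ Set.range (χ.map (𝟙 b))

/-- Affine connections: a map `(x, y, z) ↦ λ(x, y, z)` (the translate of `z` along `x`, `y`),
defined for `x ∼ y` and `x ∼ z`, subject to the book-keeping laws `y ∼ λ(x, y, z) ∼ z`, the unit
laws and the inversion law. (On a formal manifold `∼` is reflexive and symmetric, so `x ∼ x` and
`y ∼ x` hold automatically in the unit and inversion laws.) -/
structure AffineConnection (M : Cᵒᵖ ⥤ Type w') where
  lam : ∀ ⦃c : C⦄ (x y z : M.obj (op c)), Nbr J R M x y → Nbr J R M x z →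
    M.obj (op c)
  natural : ∀ ⦃b c : C⦄ (g : b ⟶ c) (x y z : M.obj (op c)) (hy : Nbr J R M x y)
    (hz : Nbr J R M x z),
    lam (res M g x) (res M g y) (res M g z) (hy.restrict J R g) (hz.restrict J R g) =
      res M g (lam x y z hy hz)
  nbr_left : ∀ ⦃c : C⦄ (x y z : M.obj (op c)) (hy : Nbr J R M x y)
    (hz : Nbr J R M x z), Nbr J R M y (lam x y z hy hz)
  nbr_right : ∀ ⦃c : C⦄ (x y z : M.obj (op c)) (hy : Nbr J R M x y)
    (hz : Nbr J R M x z), Nbr J R M z (lam x y z hy hz)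
  unit_left : ∀ ⦃c : C⦄ (x z : M.obj (op c)) (hx : Nbr J R M x x)
    (hz : Nbr J R M x z), lam x x z hx hz = z
  unit_right : ∀ ⦃c : C⦄ (x y : M.obj (op c)) (hy : Nbr J R M x y)
    (hx : Nbr J R M x x), lam x y x hy hx = y
  inversion : ∀ ⦃c : C⦄ (x y z : M.obj (op c)) (hy : Nbr J R M x y)
    (hz : Nbr J R M x z) (hyx : Nbr J R M y x),
    lam y x (lam x y z hy hz) hyx (nbr_left x y z hy hz) = z

variable {J R}

/-- Symmetric (torsion free) affine connections. -/
def AffineConnection.Symmetric {M : Cᵒᵖ ⥤ Type w'} (L : AffineConnection J R M) : Prop :=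
  ∀ ⦃c : C⦄ (x y z : M.obj (op c)) (hy : Nbr J R M x y) (hz : Nbr J R M x z),
    L.lam x y z hy hz = L.lam x z y hz hy

/-- Flat (curvature free) affine connections: for mutual neighbours `x`, `y`, `z`, translating any
neighbour `t` of `x` first along `x`, `y` and then along `y`, `z` is the same as translating it
along `x`, `z`. -/
def AffineConnection.Flat {M : Cᵒᵖ ⥤ Type w'} (L : AffineConnection J R M) : Prop :=
  ∀ ⦃c : C⦄ (x y z t : M.obj (op c)) (hxy : Nbr J R M x y) (hyz : Nbr J R M y z)
    (hxz : Nbr J R M x z) (hxt : Nbr J R M x t),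
    L.lam y z (L.lam x y t hxy hxt) hyz (L.nbr_left x y t hxy hxt) = L.lam x z t hxz hxt

variable (J R)

/-- The relation `x ∼_∞ y`: locally, there is a finite path `x ∼ y₁ ∼ y₂ ∼ ⋯ ∼ y`. -/
def NbrInfty (X : Cᵒᵖ ⥤ Type w') {c : C} (x y : X.obj (op c)) : Prop :=
  ∃ S ∈ J c, ∀ ⦃b : C⦄ (g : b ⟶ c), S g →
    Relation.ReflTransGen (fun p q : X.obj (op b) => Nbr J R X p q) (res X g x) (res X g y)

theorem NbrInfty.restrict {X : Cᵒᵖ ⥤ Type w'} {c : C} {x y : X.obj (op c)}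
    (hxy : NbrInfty J R X x y) {b : C} (g : b ⟶ c) :
    NbrInfty J R X (res X g x) (res X g y) := by
  obtain ⟨S, hS, H⟩ := hxy
  refine ⟨S.pullback g, J.pullback_stable g hS, fun a h hh => ?_⟩
  simpa [res] using H (h ≫ g) hh

/-- The `∞`-monad (infinitesimal path component) of a point `x` at stage `c`, a subobject of `M`
defined at all stages `g : b ⟶ c` over `c`. -/
def inftyMonad (M : Cᵒᵖ ⥤ Type w') {c : C} (x : M.obj (op c)) ⦃b : C⦄ (g : b ⟶ c) :
    Set (M.obj (op b)) :=
  {y | NbrInfty J R M (res M g x) y}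

/-- Restriction of points of the `∞`-monad of `x` along `h : a ⟶ b` over `c`. -/
def inftyMonad.res {M : Cᵒᵖ ⥤ Type w'} {c : C} {x : M.obj (op c)} {a b : C} (h : a ⟶ b)
    (g : b ⟶ c) (y : inftyMonad J R M x g) : inftyMonad J R M x (h ≫ g) :=
  ⟨SDG.res M h y.1, by
    have := NbrInfty.restrict J R y.2 h
    simpa [inftyMonad, SDG.res] using this⟩

/-- Affine space structures over a commutative ring `A`: for all coefficients `a₁, …, aₙ` with
sum `1`, the affine combination `a₁ x₁ + ⋯ + aₙ xₙ` of any points can be formed. The laws: the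
combination with coefficients `(0, …, 1, …, 0)` is the `i`-th point, and an affine combination
(coefficients `a`) of affine combinations (coefficients the rows of `B`) of `x₁, …, xₙ` is the
affine combination of `x₁, …, xₙ` with the expected coefficients. -/
structure AffineSpaceStructure (A : Type*) [CommRing A] (X : Type*) where
  comb : ∀ {n : ℕ} (a : Fin n → A), ∑ i, a i = 1 → (Fin n → X) → X
  comb_single : ∀ {n : ℕ} (i : Fin n) (x : Fin n → X) (h : ∑ j, Pi.single i (1 : A) j = 1),
    comb (Pi.single i 1) h x = x i
  comb_comb : ∀ {m n : ℕ} (a : Fin m → A) (B : Fin m → Fin n → A) (x : Fin n → X)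
    (ha : ∑ i, a i = 1) (hB : ∀ i, ∑ j, B i j = 1)
    (h : ∑ j, ∑ i, a i * B i j = 1),
    comb a ha (fun i => comb (B i) (hB i) x) = comb (fun j => ∑ i, a i * B i j) h x

/-- Structures of an affine space over `ℤ` on the `∞`-monad of `x`: an affine space structure on
its points at each stage over `c`, the operations being natural in the stage. -/
structure AffineStructureOnMonad (M : Cᵒᵖ ⥤ Type w') {c : C} (x : M.obj (op c)) where
  str : ∀ ⦃b : C⦄ (g : b ⟶ c), AffineSpaceStructure ℤ (inftyMonad J R M x g)
  natural : ∀ ⦃a b : C⦄ (h : a ⟶ b) (g : b ⟶ c) {n : ℕ} (k : Fin n → ℤ) (hk : ∑ i, k i = 1)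
    (y : Fin n → inftyMonad J R M x g),
    (str (h ≫ g)).comb k hk (fun i => inftyMonad.res J R h g (y i)) =
      inftyMonad.res J R h g ((str g).comb k hk y)

variable {J R}

/-- `λ(x, y, z) = y - x + z` for all points `x ∼ y`, `x ∼ z` of the `∞`-monad of `x₀`: the
right hand side is the affine combination of `y, x, z` with coefficients `1, -1, 1`. -/
def AffineStructureOnMonad.Extends {M : Cᵒᵖ ⥤ Type w'} {c : C} {x₀ : M.obj (op c)}
    (A : AffineStructureOnMonad J R M x₀) (L : AffineConnection J R M) : Prop :=
  ∀ ⦃b : C⦄ (g : b ⟶ c) (x y z : inftyMonad J R M x₀ g)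
    (hy : Nbr J R M x.1 y.1) (hz : Nbr J R M x.1 z.1),
    L.lam x.1 y.1 z.1 hy hz = ((A.str g).comb ![1, -1, 1] (by decide) ![y, x, z]).1

end SDG

/-!
In a chart, parallel transport along a first order displacement `d` from `p` is a matrix
`1 + Γ_p(d)` by the Kock–Lawvere axiom. Developing a path into the tangent space at its starting
point assigns a vector to each point of the path, and `λ(x, y, z)` goes to `y - x + z`; the
question is whether this vector depends on the path. It does not: symmetry and flatness say that
infinitesimal steps of the developed frame commute, and over `ℚ` a succession of commuting steps
acts on functions as the exponential of a nilpotent derivation that is determined by the sum of the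
steps. Measuring the steps in the chart shows that the vector is determined by the end point, and
measuring them in the tangent space shows that it determines the end point.

So locally `∞`-monads embed in vector spaces. The image is closed under `y - x + z`, as one sees by
subdividing a parallelogram into infinitesimal ones, hence under all integral affine combinations,
and these glue, being given by the same formula in all affine coordinates. Conversely `λ` determines
`y - x + z` by the same subdivision, and `y - x + z` generates the integral affine combinations.
-/

namespace SDG

section SqZero

variable {ι A : Type*}

/-- First order infinitesimal vectors: the points of `D(n)` for `ι = Fin n`. -/
def SqZero [MulZeroClass A] (d : ι → A) : Prop := ∀ i j, d i * d j = 0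

theorem SqZero.zero [MulZeroClass A] : SqZero (0 : ι → A) := fun _ _ => zero_mul 0

theorem SqZero.map [MulZeroClass A] {B F : Type*} [MulZeroClass B] [FunLike F A B]
    [MulHomClass F A B] [ZeroHomClass F A B] {d : ι → A} (hd : SqZero d) (f : F) :
    SqZero fun i => f (d i) := fun i j => by
  rw [← map_mul, hd i j, map_zero]

theorem SqZero.mulVec [CommSemiring A] [Fintype ι] {κ : Type*} {d : ι → A}
    (hd : SqZero d) (B : Matrix κ ι A) : SqZero (B.mulVec d) := fun k l => by
  rw [Matrix.mulVec, Matrix.mulVec, dotProduct, dotProduct, Finset.sum_mul_sum]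
  refine Finset.sum_eq_zero fun i _ => Finset.sum_eq_zero fun j _ => ?_
  rw [mul_mul_mul_comm, hd i j, mul_zero]

theorem coordNbr_zero_iff [CommRing A] {n : ℕ} {d : Fin n → A} : CoordNbr 0 d ↔ SqZero d := by
  simp only [CoordNbr, SqZero, Pi.zero_apply, sub_zero]

end SqZero

section Restriction

variable {C : Type u} [Category.{v} C] {R : Cᵒᵖ ⥤ CommAlgCat.{w} ℚ} {ι : Type*}

theorem res_res (X : Cᵒᵖ ⥤ Type w') {a b c : C} (h : a ⟶ b) (g : b ⟶ c) (x : X.obj (op c)) :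
    res X h (res X g x) = res X (h ≫ g) x := by
  simp [res]

theorem res_id (X : Cᵒᵖ ⥤ Type w') {c : C} (x : X.obj (op c)) : res X (𝟙 c) x = x := by
  simp [res]

theorem resR_resR {a b c : C} (h : a ⟶ b) (g : b ⟶ c) (x : R.obj (op c)) :
    resR R h (resR R g x) = resR R (h ≫ g) x := by
  simp [resR]

theorem resR_id {c : C} (x : R.obj (op c)) : resR R (𝟙 c) x = x := by
  simp [resR]

variable (R) in
/-- Restriction of generalized vectors. -/
def resV {b c : C} (g : b ⟶ c) (d : ι → R.obj (op c)) : ι → R.obj (op b) :=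
  fun i => resR R g (d i)

@[simp] theorem resV_apply {b c : C} (g : b ⟶ c) (d : ι → R.obj (op c)) (i : ι) :
    resV R g d i = resR R g (d i) := rfl

theorem resV_resV {a b c : C} (h : a ⟶ b) (g : b ⟶ c) (x : ι → R.obj (op c)) :
    resV R h (resV R g x) = resV R (h ≫ g) x :=
  funext fun i => resR_resR h g (x i)

theorem resV_id {c : C} (x : ι → R.obj (op c)) : resV R (𝟙 c) x = x :=
  funext fun i => resR_id (x i)

theorem resV_add {b c : C} (g : b ⟶ c) (x y : ι → R.obj (op c)) :
    resV R g (x + y) = resV R g x + resV R g y :=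
  funext fun i => map_add (resR R g) (x i) (y i)

theorem resV_zero {b c : C} (g : b ⟶ c) : resV R g (0 : ι → R.obj (op c)) = 0 :=
  funext fun _ => map_zero (resR R g)

theorem resR_dotProduct [Fintype ι] {b c : C} (g : b ⟶ c) (x y : ι → R.obj (op c)) :
    resR R g (x ⬝ᵥ y) = resV R g x ⬝ᵥ resV R g y :=
  RingHom.map_dotProduct (resR R g).toRingHom x y

theorem SqZero.resV {b c : C} {d : ι → R.obj (op c)} (hd : SqZero d) (g : b ⟶ c) :
    SqZero (resV R g d) :=
  hd.map (resR R g)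

end Restriction

section FirstOrder

variable {C : Type u} [Category.{v} C]

/-- The Kock–Lawvere axiom for the first order infinitesimal objects `D(n)`: every function on
`D(n)` is of the form `d ↦ f 0 + v ⬝ d` for a unique vector `v`. -/
def FirstOrderKockLawvere (R : Cᵒᵖ ⥤ CommAlgCat.{w} ℚ) : Prop :=
  ∀ (n : ℕ) (c : C)
    (f : ∀ ⦃b : C⦄, (b ⟶ c) → ∀ d : Fin n → R.obj (op b), SqZero d → R.obj (op b)),
    (∀ ⦃a b : C⦄ (h : a ⟶ b) (g : b ⟶ c) (d : Fin n → R.obj (op b)) (hd : SqZero d),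
      f (h ≫ g) (resV R h d) (hd.resV h) = resR R h (f g d hd)) →
    ∃! v : Fin n → R.obj (op c), ∀ ⦃b : C⦄ (g : b ⟶ c) (d : Fin n → R.obj (op b))
      (hd : SqZero d), f g d hd = f g 0 .zero + resV R g v ⬝ᵥ d

/-- The Weil algebra of functions on `D(n)`. -/
abbrev DualAlg (n : ℕ) := TrivSqZeroExt ℚ (Fin n → ℚ)

namespace DualAlg

variable {n : ℕ}

theorem isWeilAlgebra : IsWeilAlgebra (DualAlg n) := by
  refine ⟨inferInstanceAs (Module.Finite ℚ (ℚ × (Fin n → ℚ))), TrivSqZeroExt.fstHom ℚ ℚ _, 2, ?_⟩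
  rw [sq, Submodule.zero_eq_bot, eq_bot_iff, Ideal.mul_le]
  intro x (hx : x.fst = 0) y (hy : y.fst = 0)
  rw [Ideal.mem_bot]
  ext <;> simp [hx, hy]

/-- The `j`-th coordinate function on `D(n)`. -/
noncomputable def coord (j : Fin n) : DualAlg n := TrivSqZeroExt.inr (Pi.single j 1)

/-- The basis of the functions on `D(n)` that consists of `1` and of the coordinate functions. -/
noncomputable def basis : Module.Basis (Unit ⊕ Fin n) ℚ (DualAlg n) :=
  ((Module.Basis.singleton Unit ℚ).prod (Pi.basisFun ℚ (Fin n)) :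
    Module.Basis (Unit ⊕ Fin n) ℚ (ℚ × (Fin n → ℚ)))

theorem basis_inl (i : Unit) : (basis (Sum.inl i) : DualAlg n) = 1 := by
  change (Module.Basis.singleton Unit ℚ).prod (Pi.basisFun ℚ (Fin n)) (Sum.inl i) = (1, 0)
  ext <;> simp

theorem basis_inr (j : Fin n) : basis (Sum.inr j) = coord j := by
  change (Module.Basis.singleton Unit ℚ).prod (Pi.basisFun ℚ (Fin n)) (Sum.inr j) =
    (0, Pi.single j 1)
  ext <;> simp

variable {A : Type*} [CommRing A] [Algebra ℚ A]

theorem sqZero_map_coord (s : DualAlg n →ₐ[ℚ] A) : SqZero fun j => s (coord j) :=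
  SqZero.map (fun i j => by simp [coord]) s

/-- The point of the spectrum that corresponds to a point `d` of `D(n)`: evaluation at `d`. -/
noncomputable def eval (d : Fin n → A) (hd : SqZero d) : DualAlg n →ₐ[ℚ] A :=
  TrivSqZeroExt.liftEquivOfComm ⟨Fintype.linearCombination ℚ d, fun x y => by
    rw [Fintype.linearCombination_apply, Fintype.linearCombination_apply, Finset.sum_mul_sum]
    refine Finset.sum_eq_zero fun i _ => Finset.sum_eq_zero fun j _ => ?_
    rw [smul_mul_smul_comm, hd i j, smul_zero]⟩

theorem eval_coord (d : Fin n → A) (hd : SqZero d) (j : Fin n) : eval d hd (coord j) = d j := by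
  simp [eval, coord, Fintype.linearCombination_apply]

theorem productMap_sum_basis {B : Type*} [CommRing B] [Algebra ℚ B] (f : B →ₐ[ℚ] A)
    (s : DualAlg n →ₐ[ℚ] A) (u : Unit ⊕ Fin n → B) :
    Algebra.TensorProduct.productMap f s ((Algebra.TensorProduct.basis B basis).equivFun.symm u) =
      f (u (.inl ())) + (fun j => f (u (.inr j))) ⬝ᵥ fun j => s (coord j) := by
  simp [Module.Basis.equivFun_symm_apply, Algebra.TensorProduct.basis_apply, basis_inl, basis_inr,
    TensorProduct.smul_tmul', dotProduct]

end DualAlg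

open DualAlg in
theorem KockLawvere.firstOrder {R : Cᵒᵖ ⥤ CommAlgCat.{w} ℚ} (hKL : KockLawvere R) :
    FirstOrderKockLawvere R := by
  intro n c f hf
  obtain ⟨t, ht, ht_unique⟩ := hKL (DualAlg n) isWeilAlgebra c
    (fun b g s => f g (fun j => s (coord j)) (sqZero_map_coord s))
    (fun a b h g s => hf h g _ (sqZero_map_coord s))
  let e := (Algebra.TensorProduct.basis (R.obj (op c)) (basis (n := n))).equivFun.symm
  obtain ⟨u, rfl⟩ := e.surjective t
  simp only [e, productMap_sum_basis] at ht ht_unique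
  have expand ⦃b : C⦄ (g : b ⟶ c) (d : Fin n → R.obj (op b)) (hd : SqZero d) :
      f g d hd = resR R g (u (.inl ())) + resV R g (fun j => u (.inr j)) ⬝ᵥ d := by
    have := ht g (eval d hd)
    simp only [eval_coord] at this
    exact this
  have expand_zero ⦃b : C⦄ (g : b ⟶ c) : f g 0 .zero = resR R g (u (.inl ())) := by
    rw [expand, dotProduct_zero, add_zero]
  refine ⟨fun j => u (.inr j), fun b g d hd => ?_, fun v hv => ?_⟩
  · rw [expand, expand_zero]
  · have := ht_unique (e (Sum.elim (fun _ => u (.inl ())) v)) fun b g s => by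
      rw [hv g, expand_zero, productMap_sum_basis]
      rfl
    funext j
    exact congrFun (e.injective this) (.inr j)

namespace FirstOrderKockLawvere

variable {R : Cᵒᵖ ⥤ CommAlgCat.{w} ℚ} (hKL : FirstOrderKockLawvere R) {c : C} {n : ℕ}
include hKL

theorem slope_unique {v v' : Fin n → R.obj (op c)}
    (h : ∀ ⦃b : C⦄ (g : b ⟶ c) (d : Fin n → R.obj (op b)), SqZero d →
      resV R g v ⬝ᵥ d = resV R g v' ⬝ᵥ d) : v = v' := by
  refine (hKL n c (fun b g d _ => resV R g v ⬝ᵥ d) fun a b h g d _ => ?_).unique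
    (fun b g d _ => ?_) fun b g d hd => ?_
  · rw [resR_dotProduct, resV_resV]
  · rw [dotProduct_zero, zero_add]
  · rw [dotProduct_zero, zero_add, h g d hd]

end FirstOrderKockLawvere

end FirstOrder

section StepSystem

variable {C : Type u} [Category.{v} C]

theorem FirstOrderKockLawvere.over {R : Cᵒᵖ ⥤ CommAlgCat.{w} ℚ} (hKL : FirstOrderKockLawvere R)
    {n : ℕ} {c : C} {U : Over c}
    (f : ∀ ⦃V : Over c⦄, (V ⟶ U) → ∀ d : Fin n → R.obj (op V.left), SqZero d → R.obj (op V.left))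
    (hf : ∀ ⦃W V : Over c⦄ (h : W ⟶ V) (g : V ⟶ U) (d : Fin n → R.obj (op V.left))
      (hd : SqZero d), f (h ≫ g) (resV R h.left d) (hd.resV h.left) = resR R h.left (f g d hd)) :
    ∃! v : Fin n → R.obj (op U.left), ∀ ⦃V : Over c⦄ (g : V ⟶ U) (d : Fin n → R.obj (op V.left))
      (hd : SqZero d), f g d hd = f g 0 .zero + resV R g.left v ⬝ᵥ d := by
  let lift ⦃b : C⦄ (g : b ⟶ U.left) : Over.mk (g ≫ U.hom) ⟶ U := Over.homMk g
  have f_lift ⦃V : Over c⦄ (g : V ⟶ U) (d : Fin n → R.obj (op V.left)) (hd : SqZero d) :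
      f (lift g.left) d hd = f g d hd := by
    let i : Over.mk (g.left ≫ U.hom) ⟶ V := Over.homMk (𝟙 V.left)
    have hi : i ≫ g = lift g.left := Over.OverMorphism.ext (Category.id_comp g.left)
    have : f (lift g.left) (resV R (𝟙 V.left) d) (hd.resV _) = resR R (𝟙 V.left) (f g d hd) :=
      hi ▸ hf i g d hd
    simp only [resR_id] at this
    exact .trans (by congr; exact (resV_id d).symm) this
  obtain ⟨v, hv, hv_unique⟩ := hKL n U.left (fun b g => f (lift g)) fun a b h g d hd => by
    let m : Over.mk ((h ≫ g) ≫ U.hom) ⟶ Over.mk (g ≫ U.hom) :=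
      Over.homMk h (Category.assoc h g U.hom).symm
    exact hf m (lift g) d hd
  refine ⟨v, fun V g d hd => ?_, fun v' hv' => hv_unique v' fun b g d hd => hv' (lift g) d hd⟩
  rw [← f_lift g d, ← f_lift g 0]
  exact hv g.left d hd

/-- A system of states, defined at all stages over `c`, in which every state can be moved along
every first order infinitesimal vector. -/
structure StepSystem (R : Cᵒᵖ ⥤ CommAlgCat.{w} ℚ) (n : ℕ) (c : C) where
  State : (Over c)ᵒᵖ ⥤ Type w'
  step : ∀ ⦃U : Over c⦄, State.obj (op U) → ∀ d : Fin n → R.obj (op U.left), SqZero d →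
    State.obj (op U)
  step_zero : ∀ ⦃U : Over c⦄ (s : State.obj (op U)), step s 0 .zero = s
  res_step : ∀ ⦃V U : Over c⦄ (h : V ⟶ U) (s : State.obj (op U)) (d : Fin n → R.obj (op U.left))
    (hd : SqZero d),
    res State h (step s d hd) = step (res State h s) (resV R h.left d) (hd.resV h.left)

namespace StepSystem

variable {R : Cᵒᵖ ⥤ CommAlgCat.{w} ℚ} {n : ℕ} {c : C} (T : StepSystem.{v, u, w, w'} R n c)

/-- The order of two successive steps is irrelevant. -/
def Commutes : Prop :=
  ∀ ⦃U : Over c⦄ (s : T.State.obj (op U)) (d e : Fin n → R.obj (op U.left)) (hd : SqZero d)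
    (he : SqZero e), T.step (T.step s d hd) e he = T.step (T.step s e he) d hd

/-- The algebra of observables: the natural scalar functions of the states. -/
def Obs : Subalgebra ℚ (∀ U : Over c, T.State.obj (op U) → R.obj (op U.left)) where
  carrier := {φ | ∀ ⦃V U : Over c⦄ (h : V ⟶ U) (s : T.State.obj (op U)),
    φ V (res T.State h s) = resR R h.left (φ U s)}
  add_mem' hφ hψ V U h s := by
    simp only [Pi.add_apply, map_add, hφ h s, hψ h s]
  mul_mem' hφ hψ V U h s := by
    simp only [Pi.mul_apply, map_mul, hφ h s, hψ h s]
  algebraMap_mem' r V U h s := by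
    simp only [Pi.algebraMap_apply, AlgHom.commutes]

variable {T} in
theorem Obs.natural (φ : T.Obs) {V U : Over c} (h : V ⟶ U) (s : T.State.obj (op U)) :
    φ.1 V (res T.State h s) = resR R h.left (φ.1 U s) :=
  φ.2 h s

/-- The scalars at the base stage are constant observables. -/
instance : Algebra (R.obj (op c)) T.Obs :=
  RingHom.toAlgebra
    { toFun := fun r => ⟨fun U _ => resR R U.hom r, fun V U h s => by
        rw [resR_resR, Over.w h]⟩
      map_zero' := by ext; simp
      map_one' := by ext; simp
      map_add' := fun _ _ => by ext; simp
      map_mul' := fun _ _ => by ext; simp }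

theorem Obs.smul_apply {T : StepSystem.{v, u, w, w'} R n c} (r : R.obj (op c)) (φ : T.Obs)
    (U : Over c) (s : T.State.obj (op U)) : (r • φ).1 U s = resR R U.hom r * φ.1 U s :=
  rfl

instance : IsScalarTower ℚ (R.obj (op c)) T.Obs :=
  .of_algebraMap_eq fun r => by
    ext U _
    exact ((resR R U.hom).commutes r).symm

section

variable {T} (hKL : FirstOrderKockLawvere R)

include hKL in
theorem existsUnique_gradient (φ : T.Obs) {U : Over c} (s : T.State.obj (op U)) :
    ∃! v : Fin n → R.obj (op U.left), ∀ ⦃V : Over c⦄ (h : V ⟶ U) (d : Fin n → R.obj (op V.left))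
      (hd : SqZero d),
      φ.1 V (T.step (res T.State h s) d hd) =
        φ.1 V (res T.State h s) + resV R h.left v ⬝ᵥ d := by
  simpa only [T.step_zero] using
    hKL.over (fun V h d hd => φ.1 V (T.step (res T.State h s) d hd)) fun W V l h d hd => by
      rw [← Obs.natural, T.res_step, res_res]

/-- The gradient of an observable, with respect to steps, at a state. -/
noncomputable def gradient (φ : T.Obs) {U : Over c} (s : T.State.obj (op U)) :
    Fin n → R.obj (op U.left) :=
  (existsUnique_gradient hKL φ s).choose

theorem gradient_spec (φ : T.Obs) {V U : Over c} (h : V ⟶ U) (s : T.State.obj (op U))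
    {d : Fin n → R.obj (op V.left)} (hd : SqZero d) :
    φ.1 V (T.step (res T.State h s) d hd) =
      φ.1 V (res T.State h s) + resV R h.left (gradient hKL φ s) ⬝ᵥ d :=
  (existsUnique_gradient hKL φ s).choose_spec.1 h d hd

theorem eq_gradient {φ : T.Obs} {U : Over c} {s : T.State.obj (op U)}
    {v : Fin n → R.obj (op U.left)}
    (hv : ∀ ⦃V : Over c⦄ (h : V ⟶ U) (d : Fin n → R.obj (op V.left)) (hd : SqZero d),
      φ.1 V (T.step (res T.State h s) d hd) =
        φ.1 V (res T.State h s) + resV R h.left v ⬝ᵥ d) :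
    gradient hKL φ s = v :=
  ((existsUnique_gradient hKL φ s).choose_spec.2 v hv).symm

theorem gradient_res (φ : T.Obs) {V U : Over c} (h : V ⟶ U) (s : T.State.obj (op U)) :
    gradient hKL φ (res T.State h s) = resV R h.left (gradient hKL φ s) :=
  eq_gradient hKL fun W l d hd => by
    rw [res_res, gradient_spec, resV_resV, Over.comp_left]

theorem obs_step (φ : T.Obs) {U : Over c} (s : T.State.obj (op U)) {d : Fin n → R.obj (op U.left)}
    (hd : SqZero d) : φ.1 U (T.step s d hd) = φ.1 U s + gradient hKL φ s ⬝ᵥ d := by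
  simpa only [res_id, Over.id_left, resV_id] using gradient_spec hKL φ (𝟙 U) s hd

end

variable (hKL : FirstOrderKockLawvere R)

/-- The partial derivative of the observables, with respect to steps, in the `j`-th direction. -/
noncomputable def partialDeriv (j : Fin n) : Module.End (R.obj (op c)) T.Obs where
  toFun φ := ⟨fun U s => gradient hKL φ s j, fun V U h s => congrFun (gradient_res hKL φ h s) j⟩
  map_add' φ ψ := by
    ext U s
    refine congrFun (eq_gradient hKL (φ := φ + ψ) (v := gradient hKL φ s + gradient hKL ψ s)
      fun V h d hd => ?_) j
    change φ.1 V _ + ψ.1 V _ = φ.1 V _ + ψ.1 V _ + resV R h.left (_ + _) ⬝ᵥ d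
    rw [gradient_spec, gradient_spec, resV_add, add_dotProduct, add_add_add_comm]
  map_smul' r φ := by
    ext U s
    refine congrFun (eq_gradient hKL (φ := r • φ) (v := resR R U.hom r • gradient hKL φ s)
      fun V h d hd => ?_) j
    rw [Obs.smul_apply, Obs.smul_apply, gradient_spec hKL, mul_add]
    congr 1
    rw [← Over.w h, ← resR_resR]
    change _ = (fun i => resR R h.left (_ * _)) ⬝ᵥ d
    simp only [dotProduct, resV_apply, Finset.mul_sum, map_mul, mul_assoc]

/-- The derivation of the observables along the constant vector field `v`. -/
noncomputable def lieDeriv (v : Fin n → R.obj (op c)) : Module.End (R.obj (op c)) T.Obs :=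
  ∑ j, v j • T.partialDeriv hKL j

theorem lieDeriv_apply (v : Fin n → R.obj (op c)) (φ : T.Obs) {U : Over c}
    (s : T.State.obj (op U)) :
    (T.lieDeriv hKL v φ).1 U s = resV R U.hom v ⬝ᵥ gradient hKL φ s := by
  simp only [lieDeriv, LinearMap.sum_apply, LinearMap.smul_apply, AddSubmonoidClass.coe_finsetSum,
    Finset.sum_apply, Obs.smul_apply]
  rfl

theorem lieDeriv_zero : T.lieDeriv hKL 0 = 0 := by
  simp [lieDeriv]

theorem lieDeriv_add (v w : Fin n → R.obj (op c)) :
    T.lieDeriv hKL (v + w) = T.lieDeriv hKL v + T.lieDeriv hKL w := by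
  simp only [lieDeriv, Pi.add_apply, add_smul, Finset.sum_add_distrib]

theorem lieDeriv_sq {d : Fin n → R.obj (op c)} (hd : SqZero d) :
    T.lieDeriv hKL d ^ 2 = 0 := by
  rw [sq, lieDeriv, Finset.sum_mul_sum]
  refine Finset.sum_eq_zero fun i _ => Finset.sum_eq_zero fun j _ => ?_
  rw [smul_mul_smul_comm, hd i j, zero_smul]

theorem exp_lieDeriv {d : Fin n → R.obj (op c)} (hd : SqZero d) :
    IsNilpotent.exp (T.lieDeriv hKL d) = 1 + T.lieDeriv hKL d := by
  rw [IsNilpotent.exp_eq_sum (T.lieDeriv_sq hKL hd)]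
  simp [Finset.sum_range_succ]

variable {T}

theorem Obs.apply_step (φ : T.Obs) {U : Over c} (s : T.State.obj (op U)) {d : Fin n → R.obj (op c)}
    {e : Fin n → R.obj (op U.left)} (he : SqZero e) (hde : resV R U.hom d = e) :
    φ.1 U (T.step s e he) = φ.1 U s + (T.lieDeriv hKL d φ).1 U s := by
  rw [obs_step hKL, dotProduct_comm, ← hde, ← lieDeriv_apply]

theorem Commutes.commute_lieDeriv (hT : T.Commutes) {d e : Fin n → R.obj (op c)} (hd : SqZero d)
    (he : SqZero e) : Commute (T.lieDeriv hKL d) (T.lieDeriv hKL e) := by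
  refine LinearMap.ext fun φ => Subtype.ext <| funext fun U => funext fun s => ?_
  have hd := hd.resV U.hom
  have he := he.resV U.hom
  have := congrArg (φ.1 U) (hT s _ _ hd he)
  simp only [Obs.apply_step hKL _ _ hd rfl, Obs.apply_step hKL _ _ he rfl] at this
  simp only [Module.End.mul_apply]
  linear_combination this

/-- `Reaches s v t` says that a finite number of steps with sum `v` leads from `s` to `t`. -/
inductive Reaches (T : StepSystem.{v, u, w, w'} R n c) (s : T.State.obj (op (Over.mk (𝟙 c)))) :
    (Fin n → R.obj (op c)) → T.State.obj (op (Over.mk (𝟙 c))) → Prop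
  | refl : Reaches T s 0 s
  | step {v : Fin n → R.obj (op c)} {t : T.State.obj (op (Over.mk (𝟙 c)))}
      (h : Reaches T s v t) (d : Fin n → R.obj (op c)) (hd : SqZero d) :
      Reaches T s (v + d) (T.step t d hd)

namespace Reaches

variable {s t t' : T.State.obj (op (Over.mk (𝟙 c)))} {v : Fin n → R.obj (op c)}

theorem commute_lieDeriv (hT : T.Commutes) (h : T.Reaches s v t) {d : Fin n → R.obj (op c)}
    (hd : SqZero d) : Commute (T.lieDeriv hKL v) (T.lieDeriv hKL d) := by
  induction h with
  | refl => rw [lieDeriv_zero]; exact .zero_left _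
  | step _ e he ih => rw [lieDeriv_add]; exact ih.add_left (hT.commute_lieDeriv hKL he hd)

theorem isNilpotent_lieDeriv (hT : T.Commutes) (h : T.Reaches s v t) :
    IsNilpotent (T.lieDeriv hKL v) := by
  induction h with
  | refl => rw [lieDeriv_zero]; exact .zero
  | step h d hd ih =>
    rw [lieDeriv_add]
    exact (h.commute_lieDeriv hKL hT hd).isNilpotent_add ih ⟨2, T.lieDeriv_sq hKL hd⟩

theorem apply_eq_exp (hT : T.Commutes) (h : T.Reaches s v t) (φ : T.Obs) :
    φ.1 _ t = (IsNilpotent.exp (T.lieDeriv hKL v) φ).1 _ s := by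
  induction h generalizing φ with
  | refl => rw [lieDeriv_zero, IsNilpotent.exp_zero]; rfl
  | @step v t h d hd ih =>
    have comm := h.commute_lieDeriv hKL hT hd
    have nilp : IsNilpotent (T.lieDeriv hKL v) := h.isNilpotent_lieDeriv hKL hT
    have nilp' : IsNilpotent (T.lieDeriv hKL d) := ⟨2, T.lieDeriv_sq hKL hd⟩
    rw [lieDeriv_add, IsNilpotent.exp_add_of_commute comm nilp nilp', exp_lieDeriv T hKL hd,
      Module.End.mul_apply, ← ih]
    exact Obs.apply_step hKL φ t hd (resV_id d)

include hKL in
theorem apply_eq_apply (hT : T.Commutes) (h : T.Reaches s v t) (h' : T.Reaches s v t')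
    (φ : T.Obs) : φ.1 _ t = φ.1 _ t' := by
  rw [h.apply_eq_exp hKL hT, h'.apply_eq_exp hKL hT]

end Reaches

end StepSystem

end StepSystem

section FirstOrder

variable {C : Type u} [Category.{v} C] {R : Cᵒᵖ ⥤ CommAlgCat.{w} ℚ}

theorem FirstOrderKockLawvere.exists_slope_of_relation (hKL : FirstOrderKockLawvere R) {c : C}
    {m : ℕ} {ι : Type*}
    {P : ∀ ⦃b : C⦄, (b ⟶ c) → (Fin m → R.obj (op b)) → (ι → R.obj (op b)) → Prop}
    (hex : ∀ ⦃b : C⦄ (g : b ⟶ c) (d : Fin m → R.obj (op b)), SqZero d → ∃ v, P g d v)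
    (huniq : ∀ ⦃b : C⦄ {g : b ⟶ c} {d : Fin m → R.obj (op b)} {v v' : ι → R.obj (op b)},
      P g d v → P g d v' → v = v')
    (hres : ∀ ⦃a b : C⦄ (h : a ⟶ b) {g : b ⟶ c} {d : Fin m → R.obj (op b)}
      {v : ι → R.obj (op b)}, P g d v → P (h ≫ g) (resV R h d) (resV R h v))
    {v₀ : ι → R.obj (op c)} (hv₀ : P (𝟙 c) 0 v₀) :
    ∃ A : Matrix ι (Fin m) (R.obj (op c)), ∀ ⦃b : C⦄ (g : b ⟶ c) (d : Fin m → R.obj (op b)),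
      SqZero d → P g d (resV R g v₀ + (A.map (resR R g)).mulVec d) := by
  choose f hf using hex
  choose A hA _ using fun i => hKL m c (fun b g d hd => f g d hd i) fun a b h g d hd =>
    congrFun (huniq (hf (h ≫ g) _ (hd.resV h)) (hres h (hf g d hd))) i
  refine ⟨A, fun b g d hd => ?_⟩
  have f_zero : f g 0 .zero = resV R g v₀ := by
    have := hres g hv₀
    rw [Category.comp_id, resV_zero] at this
    exact huniq (hf g 0 .zero) this
  convert hf g d hd using 1
  funext i
  rw [hA i g d hd, f_zero]
  rfl

end FirstOrder

section Charts

variable {C : Type u} [Category.{v} C] {J : GrothendieckTopology C}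
  {R : Cᵒᵖ ⥤ CommAlgCat.{w} ℚ} {M : Cᵒᵖ ⥤ Type w'}

theorem eq_of_locally_eq {X : Cᵒᵖ ⥤ Type w'} (hX : Presieve.IsSeparated J X) {c : C}
    {x y : X.obj (op c)} {S : Sieve c} (hS : S ∈ J c)
    (h : ∀ ⦃b : C⦄ (g : b ⟶ c), S g → res X g x = res X g y) : x = y :=
  (hX S hS).ext fun _ g hg => h g hg

theorem scalar_eq_of_locally_eq (hR : Presieve.IsSeparated J (R ⋙ forget (CommAlgCat ℚ))) {c : C}
    {x y : R.obj (op c)} {S : Sieve c} (hS : S ∈ J c)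
    (h : ∀ ⦃b : C⦄ (g : b ⟶ c), S g → resR R g x = resR R g y) : x = y :=
  (hR S hS).ext fun _ g hg => h g hg

theorem Nbr.of_locally {X : Cᵒᵖ ⥤ Type w'} {c : C} {x y : X.obj (op c)} {S : Sieve c}
    (hS : S ∈ J c) (h : ∀ ⦃b : C⦄ (g : b ⟶ c), S g → Nbr J R X (res X g x) (res X g y)) :
    Nbr J R X x y := by
  choose T hT H using h
  refine ⟨Sieve.bind S fun b g hg => T g hg, J.bind_covering hS fun b g hg => hT g hg, ?_⟩
  rintro a _ ⟨b, h, g, hg, hh, rfl⟩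
  obtain ⟨m, f, o, d, ho, h0, h1⟩ := H g hg h hh
  exact ⟨m, f, o, d, ho, by rw [h0, res_res], by rw [h1, res_res]⟩

namespace Figure

variable {X : Cᵒᵖ ⥤ Type w'} {m : ℕ} {b c : C}

/-- A figure restricted along a map of stages. -/
def restrict (f : Figure R X m c) (g : b ⟶ c) : Figure R X m b where
  toFun _ h d := f.toFun (h ≫ g) d
  natural a b h g' d d' hd := by
    rw [Category.assoc]
    exact f.natural h (g' ≫ g) d d' hd

/-- The value of a figure at a point of `D(m)`, with `D(m)` described by `SqZero`. -/
def eval (f : Figure R X m c) (g : b ⟶ c) (d : Fin m → R.obj (op b)) (hd : SqZero d) :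
    X.obj (op b) :=
  f.toFun g ⟨d, coordNbr_zero_iff.2 hd⟩

theorem res_eval (f : Figure R X m c) {a : C} (h : a ⟶ b) (g : b ⟶ c) {d : Fin m → R.obj (op b)}
    (hd : SqZero d) : res X h (f.eval g d hd) = f.eval (h ≫ g) (resV R h d) (hd.resV h) :=
  (f.natural h g _ _ fun _ => rfl).symm

theorem nbr_eval (f : Figure R X m c) (g : b ⟶ c) {d : Fin m → R.obj (op b)} (hd : SqZero d) :
    Nbr J R X (f.eval g 0 .zero) (f.eval g d hd) :=
  ⟨⊤, J.top_mem b, fun a h _ => ⟨m, f.restrict (h ≫ g), ⟨0, coordNbr_zero_iff.2 .zero⟩,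
    ⟨resV R h d, coordNbr_zero_iff.2 (hd.resV h)⟩, rfl, by
      rw [res_eval]
      simp only [restrict, eval, Category.id_comp, resV_zero], by
      rw [res_eval]
      simp only [restrict, eval, Category.id_comp]⟩⟩

end Figure

theorem Nbr.exists_figure {X : Cᵒᵖ ⥤ Type w'} {c : C} {x y : X.obj (op c)} (h : Nbr J R X x y) :
    ∃ S ∈ J c, ∀ ⦃b : C⦄ (g : b ⟶ c), S g → ∃ (m : ℕ) (f : Figure R X m b)
      (d : Fin m → R.obj (op b)) (hd : SqZero d),
      f.eval (𝟙 b) 0 .zero = res X g x ∧ f.eval (𝟙 b) d hd = res X g y := by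
  obtain ⟨S, hS, H⟩ := h
  refine ⟨S, hS, fun b g hg => ?_⟩
  obtain ⟨m, f, ⟨_, h0⟩, ⟨d, hd⟩, rfl, hx, hy⟩ := H g hg
  exact ⟨m, f, d, coordNbr_zero_iff.1 hd, hx, hy⟩

namespace Chart

variable {n : ℕ} {c : C} (χ : Chart J R M n c)

/-- The point `x` of `M` has the coordinates `p` in the chart `χ`. -/
def At {b : C} (g : b ⟶ c) (p : Fin n → R.obj (op b)) (x : M.obj (op b)) : Prop :=
  ∃ hp : p ∈ χ.dom g, χ.map g ⟨p, hp⟩ = x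

variable {χ} {b : C} {g : b ⟶ c} {p q d : Fin n → R.obj (op b)} {x y : M.obj (op b)}

theorem exists_at (hp : p ∈ χ.dom g) : ∃ x, χ.At g p x := ⟨_, hp, rfl⟩

theorem At.mem_dom (h : χ.At g p x) : p ∈ χ.dom g := h.1

theorem At.point_eq (hx : χ.At g p x) (hy : χ.At g p y) : x = y := by
  obtain ⟨_, rfl⟩ := hx
  obtain ⟨_, rfl⟩ := hy
  rfl

theorem At.coord_eq (hp : χ.At g p x) (hq : χ.At g q x) : p = q := by
  obtain ⟨_, rfl⟩ := hp
  obtain ⟨_, h⟩ := hq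
  exact (congrArg Subtype.val (χ.map_injective g h)).symm

theorem At.restrict {a : C} (hp : χ.At g p x) (h : a ⟶ b) :
    χ.At (h ≫ g) (resV R h p) (res M h x) := by
  obtain ⟨hp, rfl⟩ := hp
  exact ⟨χ.dom_res h g p hp, χ.map_natural h g ⟨p, hp⟩⟩

theorem mem_dom_add (hp : p ∈ χ.dom g) (hd : SqZero d) : p + d ∈ χ.dom g :=
  χ.dom_open g p _ hp fun i j => by
    rw [Pi.add_apply, Pi.add_apply, add_sub_cancel_left, add_sub_cancel_left, hd i j]

theorem resV_mem_dom {a : C} (h : a ⟶ b) (hp : p ∈ χ.dom g) : resV R h p ∈ χ.dom (h ≫ g) :=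
  χ.dom_res h g p hp

theorem At.exists_of_nbr (hp : χ.At g p x) (h : Nbr J R M x y) : ∃ q, χ.At g q y := by
  obtain ⟨hp, hx⟩ := hp
  obtain ⟨⟨q, hq⟩, hy⟩ := χ.range_open g x y ⟨_, hx⟩ h
  exact ⟨q, hq, hy⟩

/-- The figure `d ↦ p + d` around a point of a chart. -/
def figure (χ : Chart J R M n c) (hp : p ∈ χ.dom g) : Figure R M n b where
  toFun _ h e := χ.map (h ≫ g) ⟨resV R h p + e.1,
    mem_dom_add (resV_mem_dom h hp) (coordNbr_zero_iff.1 e.2)⟩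
  natural a a' l h d d' hd' := by
    have hd : resV R l d.1 = d'.1 := (funext hd').symm
    have := At.restrict (χ := χ) ⟨mem_dom_add (resV_mem_dom h hp) (coordNbr_zero_iff.1 d.2), rfl⟩ l
    simp only [resV_add, resV_resV, hd, ← Category.assoc] at this
    exact At.point_eq ⟨_, rfl⟩ this

theorem At.nbr (hp : χ.At g p x) (hq : χ.At g (p + d) y) (hd : SqZero d) : Nbr J R M x y := by
  have at_eval {e : Fin n → R.obj (op b)} (he : SqZero e) :
      χ.At g (p + e) ((χ.figure hp.mem_dom).eval (𝟙 b) e he) := by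
    have : χ.At (𝟙 b ≫ g) (resV R (𝟙 b) p + e) ((χ.figure hp.mem_dom).eval (𝟙 b) e he) :=
      ⟨_, rfl⟩
    rwa [Category.id_comp, resV_id] at this
  have at_zero := at_eval SqZero.zero
  rw [add_zero] at at_zero
  rw [hp.point_eq at_zero, hq.point_eq (at_eval hd)]
  exact (χ.figure hp.mem_dom).nbr_eval (𝟙 b) hd

theorem At.sqZero_of_nbr (hR : Presieve.IsSeparated J (R ⋙ forget (CommAlgCat ℚ)))
    (hKL : FirstOrderKockLawvere R) (hp : χ.At g p x) (hq : χ.At g q y) (hxy : Nbr J R M x y) :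
    SqZero (q - p) := by
  obtain ⟨S, hS, H⟩ := hxy.exists_figure
  refine fun i j => scalar_eq_of_locally_eq hR hS fun a h hh => ?_
  obtain ⟨m, f, d, hd, hx, hy⟩ := H h hh
  replace hp := hp.restrict h
  replace hq := hq.restrict h
  rw [← hx] at hp
  rw [← hy] at hq
  -- A figure in a chart is an affine map, so it takes `D(m)` into a translate of `D(n)`.
  obtain ⟨A, hA⟩ := hKL.exists_slope_of_relation
    (P := fun a' l e r => ∃ he : SqZero e, χ.At (l ≫ h ≫ g) r (f.eval l e he))
    (fun a' l e he => by
      have := hp.restrict l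
      simp only [Figure.res_eval, Category.comp_id, resV_zero] at this
      obtain ⟨r, hr⟩ := this.exists_of_nbr (f.nbr_eval l he)
      exact ⟨r, he, hr⟩)
    (fun a' l e r r' ⟨_, hr⟩ ⟨_, hr'⟩ => hr.coord_eq hr')
    (fun a'' a' k l e r ⟨he, hr⟩ => ⟨he.resV k, by
      have := hr.restrict k
      rwa [Figure.res_eval, ← Category.assoc] at this⟩)
    ⟨.zero, by rwa [Category.id_comp]⟩
  obtain ⟨_, hA⟩ := hA (𝟙 a) d hd
  rw [Category.id_comp, resV_id] at hA
  have hdiff := hd.mulVec (A.map (resR R (𝟙 a))) i j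
  rw [← sub_eq_of_eq_add' (hq.coord_eq hA)] at hdiff
  simpa using hdiff

theorem At.exists_add_of_nbr (hR : Presieve.IsSeparated J (R ⋙ forget (CommAlgCat ℚ)))
    (hKL : FirstOrderKockLawvere R) (hp : χ.At g p x) (hxy : Nbr J R M x y) :
    ∃ d, SqZero d ∧ χ.At g (p + d) y := by
  obtain ⟨q, hq⟩ := hp.exists_of_nbr hxy
  exact ⟨q - p, hp.sqZero_of_nbr hR hKL hq hxy, by rwa [add_sub_cancel]⟩

theorem At.nbr_symm (hR : Presieve.IsSeparated J (R ⋙ forget (CommAlgCat ℚ)))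
    (hKL : FirstOrderKockLawvere R) (hp : χ.At g p x) (hxy : Nbr J R M x y) : Nbr J R M y x := by
  obtain ⟨d, hd, hq⟩ := hp.exists_add_of_nbr hR hKL hxy
  refine hq.nbr (d := -d) (by rwa [add_neg_cancel_right]) fun i j => ?_
  rw [Pi.neg_apply, Pi.neg_apply, neg_mul_neg, hd i j]

end Chart

theorem IsFormalManifold.nbr_symm (hR : Presieve.IsSeparated J (R ⋙ forget (CommAlgCat ℚ)))
    (hKL : FirstOrderKockLawvere R) (hman : IsFormalManifold J R M) {c : C} {x y : M.obj (op c)}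
    (hxy : Nbr J R M x y) : Nbr J R M y x := by
  obtain ⟨S, hS, H⟩ := hman x
  refine Nbr.of_locally hS fun b g hg => ?_
  obtain ⟨n, χ, ⟨p, hp⟩, hx⟩ := H g hg
  exact Chart.At.nbr_symm hR hKL (χ := χ) (g := 𝟙 b) (p := p) ⟨hp, hx⟩ (hxy.restrict J R g)

end Charts

section LinearForms

variable {A : Type*} [CommRing A] {n : ℕ}

/-- The matrix valued linear form with the coefficients `Γ`: for the Christoffel symbols `Γ` of a
connection this is the connection form. -/
def matForm (Γ : Fin n → Matrix (Fin n) (Fin n) A) : (Fin n → A) →ₗ[A] Matrix (Fin n) (Fin n) A :=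
  Fintype.linearCombination A Γ

theorem matForm_apply (Γ : Fin n → Matrix (Fin n) (Fin n) A) (d : Fin n → A) :
    matForm Γ d = ∑ i, d i • Γ i :=
  Fintype.linearCombination_apply A Γ d

theorem matForm_mul_matForm (Γ Γ' : Fin n → Matrix (Fin n) (Fin n) A) (d e : Fin n → A) :
    matForm Γ d * matForm Γ' e = ∑ i, ∑ j, (d i * e j) • (Γ i * Γ' j) := by
  simp only [matForm_apply, Finset.sum_mul_sum, smul_mul_smul_comm]

theorem matForm_mul_matForm_eq_zero (Γ Γ' : Fin n → Matrix (Fin n) (Fin n) A) {d e : Fin n → A}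
    (h : ∀ i j, d i * e j = 0) : matForm Γ d * matForm Γ' e = 0 := by
  simp only [matForm_mul_matForm, h, zero_smul, Finset.sum_const_zero]

theorem SqZero.one_add_mul_one_sub {d : Fin n → A} (hd : SqZero d)
    (Γ : Fin n → Matrix (Fin n) (Fin n) A) : (1 + matForm Γ d) * (1 - matForm Γ d) = 1 := by
  have : matForm Γ d * matForm Γ d = 0 := matForm_mul_matForm_eq_zero Γ Γ hd
  rw [add_mul, one_mul, mul_sub, mul_one, this, sub_zero, sub_add_cancel]

theorem SqZero.one_sub_mul_one_add {d : Fin n → A} (hd : SqZero d)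
    (Γ : Fin n → Matrix (Fin n) (Fin n) A) : (1 - matForm Γ d) * (1 + matForm Γ d) = 1 :=
  mul_eq_one_comm.1 (hd.one_add_mul_one_sub Γ)

theorem matForm_mulVec_mul_eq_zero (Γ : Fin n → Matrix (Fin n) (Fin n) A) {d e f : Fin n → A}
    (h : ∀ i j, d i * f j = 0) (i j : Fin n) : (matForm Γ d).mulVec e i * f j = 0 := by
  simp only [matForm_apply, Matrix.sum_mulVec, Finset.sum_apply, Matrix.smul_mulVec,
    Pi.smul_apply, smul_eq_mul, Finset.sum_mul, mul_right_comm, h, zero_mul, Finset.sum_const_zero]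

theorem matForm_deriv (Γ : Fin n → Matrix (Fin n) (Fin n) A)
    (D : Fin n → Fin n → Matrix (Fin n) (Fin n) A) (d e : Fin n → A) :
    matForm (fun i => Γ i + ∑ m, d m • D m i) e =
      matForm Γ e + ∑ m, ∑ i, (d m * e i) • D m i := by
  simp only [matForm_apply, smul_add, Finset.sum_add_distrib, Finset.smul_sum, smul_smul]
  rw [Finset.sum_comm (γ := Fin n)]
  simp only [mul_comm]

theorem one_add_matForm_mul (Γ : Fin n → Matrix (Fin n) (Fin n) A)
    (D : Fin n → Fin n → Matrix (Fin n) (Fin n) A) {d e : Fin n → A} (hd : SqZero d) :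
    (1 + matForm (fun i => Γ i + ∑ m, d m • D m i) e) * (1 + matForm Γ d) =
      1 + matForm Γ (d + e) + ∑ m, ∑ i, (d m * e i) • (D m i + Γ i * Γ m) := by
  have h0 : (∑ m, ∑ i, (d m * e i) • D m i) * matForm Γ d = 0 := by
    simp only [matForm_apply, Finset.sum_mul, Finset.mul_sum, smul_mul_smul_comm]
    refine Finset.sum_eq_zero fun i _ => Finset.sum_eq_zero fun j _ =>
      Finset.sum_eq_zero fun k _ => ?_
    rw [mul_right_comm, hd, zero_mul, zero_smul]
  have h1 : matForm Γ e * matForm Γ d = ∑ m, ∑ i, (d m * e i) • (Γ i * Γ m) := by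
    rw [matForm_mul_matForm, Finset.sum_comm]
    simp only [mul_comm]
  rw [matForm_deriv, map_add]
  simp only [add_mul, mul_add, one_mul, mul_one, h0, h1, smul_add, Finset.sum_add_distrib]
  abel

theorem sqZero_single_add_single {i j : Fin n} {s t : A} (hs : s * s = 0) (ht : t * t = 0)
    (hst : s * t = 0) : SqZero (Pi.single i s + Pi.single j t : Fin n → A) := by
  intro k l
  have hts : t * s = 0 := by rw [mul_comm, hst]
  simp only [Pi.add_apply, Pi.single_apply, add_mul, mul_add, ite_mul, mul_ite, hs, ht, hst, hts,
    mul_zero, zero_mul, ite_self, add_zero]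

theorem sum_sum_single_smul {E : Type*} [AddCommGroup E] [Module A E] (B : Fin n → Fin n → E)
    (i j : Fin n) (s t s' t' : A) :
    ∑ m, ∑ k, ((Pi.single i s + Pi.single j t : Fin n → A) m *
        (Pi.single i s' + Pi.single j t' : Fin n → A) k) • B m k =
      (s * s') • B i i + (s * t') • B i j + (t * s') • B j i + (t * t') • B j j := by
  simp only [Pi.add_apply, add_mul, mul_add, add_smul, Finset.sum_add_distrib, Pi.single_apply,
    ite_mul, mul_ite, zero_mul, mul_zero, ite_smul, zero_smul, Finset.sum_ite_eq',
    Finset.mem_univ, if_true]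
  abel

theorem prod_smul_sub_eq_zero_of_mutual_nbrs {E : Type*} [AddCommGroup E] [Module A E]
    {B : Fin n → Fin n → E}
    (hB : ∀ d e : Fin n → A, SqZero d → SqZero e → SqZero (d + e) →
      ∑ i, ∑ j, (d i * e j) • B i j = 0)
    (i j : Fin n) {s : Fin 4 → A} (hs : ∀ k, s k * s k = 0) :
    (∏ k, s k) • (B i j - B j i) = 0 := by
  -- `d = s₀ (s₁ eᵢ - s₂ eⱼ)` and `e = s₃ (s₁ eᵢ + s₂ eⱼ)`, so that `d i * e i = d j * e j = 0`
  -- and `d i * e j = - d j * e i`.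
  have hsum := hB (Pi.single i (s 0 * s 1) + Pi.single j (-(s 0 * s 2)))
    (Pi.single i (s 3 * s 1) + Pi.single j (s 3 * s 2))
    (sqZero_single_add_single (by linear_combination s 1 ^ 2 * hs 0)
      (by linear_combination s 2 ^ 2 * hs 0) (by linear_combination -(s 1 * s 2) * hs 0))
    (sqZero_single_add_single (by linear_combination s 1 ^ 2 * hs 3)
      (by linear_combination s 2 ^ 2 * hs 3) (by linear_combination (s 1 * s 2) * hs 3))
    (by
      rw [add_add_add_comm, ← Pi.single_add, ← Pi.single_add]
      refine sqZero_single_add_single ?_ ?_ ?_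
      · linear_combination (s 0 + s 3) ^ 2 * hs 1
      · linear_combination (s 3 - s 0) ^ 2 * hs 2
      · linear_combination -(s 1 * s 2) * hs 0 + s 1 * s 2 * hs 3)
  have hii : s 0 * s 1 * (s 3 * s 1) = 0 := by linear_combination s 0 * s 3 * hs 1
  have hjj : -(s 0 * s 2) * (s 3 * s 2) = 0 := by linear_combination -(s 0 * s 3) * hs 2
  rw [sum_sum_single_smul, hii, hjj, zero_smul, zero_smul, zero_add, add_zero] at hsum
  rw [Fin.prod_univ_four, smul_sub, ← hsum, sub_eq_add_neg, ← neg_smul]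
  congr 2 <;> ring

end LinearForms

section MatrixRestriction

variable {C : Type u} [Category.{v} C] {R : Cᵒᵖ ⥤ CommAlgCat.{w} ℚ} {n : ℕ}

variable (R) in
/-- Restriction of matrices of generalized scalars. -/
abbrev resM {b c : C} (g : b ⟶ c) :
    Matrix (Fin n) (Fin n) (R.obj (op c)) →ₐ[ℚ] Matrix (Fin n) (Fin n) (R.obj (op b)) :=
  (resR R g).mapMatrix

theorem resM_resM {a b c : C} (h : a ⟶ b) (g : b ⟶ c)
    (F : Matrix (Fin n) (Fin n) (R.obj (op c))) : resM R h (resM R g F) = resM R (h ≫ g) F := by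
  ext i j
  exact resR_resR h g _

theorem resM_id {c : C} (F : Matrix (Fin n) (Fin n) (R.obj (op c))) : resM R (𝟙 c) F = F := by
  ext i j
  exact resR_id _

theorem resV_mulVec {b c : C} (g : b ⟶ c) (F : Matrix (Fin n) (Fin n) (R.obj (op c)))
    (d : Fin n → R.obj (op c)) : resV R g (F.mulVec d) = (resM R g F).mulVec (resV R g d) :=
  funext fun i => resR_dotProduct g (F i) d

theorem resM_matForm {b c : C} (g : b ⟶ c) (Γ : Fin n → Matrix (Fin n) (Fin n) (R.obj (op c)))
    (d : Fin n → R.obj (op c)) :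
    resM R g (matForm Γ d) = matForm (fun i => resM R g (Γ i)) (resV R g d) := by
  ext i j
  simp [matForm_apply, Matrix.sum_apply]

namespace FirstOrderKockLawvere

variable (hKL : FirstOrderKockLawvere R) {c : C}
include hKL

theorem matrix_ext {F F' : Matrix (Fin n) (Fin n) (R.obj (op c))}
    (h : ∀ ⦃b : C⦄ (g : b ⟶ c) (d : Fin n → R.obj (op b)), SqZero d →
      (resM R g F).mulVec d = (resM R g F').mulVec d) : F = F' :=
  funext fun i => hKL.slope_unique fun _ g d hd => congrFun (h g d hd) i

theorem matForm_injective {Γ Γ' : Fin n → Matrix (Fin n) (Fin n) (R.obj (op c))}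
    (h : ∀ ⦃b : C⦄ (g : b ⟶ c) (d : Fin n → R.obj (op b)), SqZero d →
      matForm (fun i => resM R g (Γ i)) d = matForm (fun i => resM R g (Γ' i)) d) : Γ = Γ' := by
  have h_entry (j k : Fin n) : (fun i => Γ i j k) = fun i => Γ' i j k :=
    hKL.slope_unique fun b g d hd => by
      have := congrFun (congrFun (h g d hd) j) k
      simp only [matForm_apply, Matrix.sum_apply, Matrix.smul_apply, smul_eq_mul] at this
      rw [dotProduct_comm, dotProduct_comm _ d]
      exact this
  funext i
  ext j k
  exact congrFun (h_entry j k) i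

theorem eq_zero_of_mul_sqZero {r : R.obj (op c)}
    (h : ∀ ⦃b : C⦄ (g : b ⟶ c) (s : R.obj (op b)), s * s = 0 → resR R g r * s = 0) : r = 0 := by
  have : (fun _ : Fin 1 => r) = 0 := hKL.slope_unique fun b g d hd => by
    simpa [dotProduct] using h g (d 0) (hd 0 0)
  exact congrFun this 0

theorem eq_zero_of_mul_prod_sqZero : ∀ {k : ℕ} {c : C} {r : R.obj (op c)},
    (∀ ⦃b : C⦄ (g : b ⟶ c) (s : Fin k → R.obj (op b)), (∀ i, s i * s i = 0) →
      resR R g r * ∏ i, s i = 0) → r = 0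
  | 0, c, r, h => by simpa [resR_id] using h (𝟙 c) 0 fun i => i.elim0
  | k + 1, c, r, h => by
    refine hKL.eq_zero_of_mul_sqZero fun b g s hs => ?_
    refine eq_zero_of_mul_prod_sqZero (k := k) fun a l t ht => ?_
    have := h (l ≫ g) (Fin.cons (resR R l s) t) (Fin.cases (by
      rw [Fin.cons_zero, ← map_mul, hs, map_zero]) ht)
    rwa [Fin.prod_cons, ← mul_assoc, ← resR_resR, ← map_mul] at this

end FirstOrderKockLawvere

end MatrixRestriction

section Christoffel

variable {C : Type u} [Category.{v} C] {J : GrothendieckTopology C}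
  {R : Cᵒᵖ ⥤ CommAlgCat.{w} ℚ} {M : Cᵒᵖ ⥤ Type w'} {n : ℕ}

namespace Chart

variable {c : C} (χ : Chart J R M n c) (L : AffineConnection J R M)

/-- In coordinates, the connection takes the points `p`, `p + d`, `p + e` to `p + d + e'`: the
vector `e'` at `p + d` is the parallel translate of the vector `e` at `p`. -/
def Transports {b : C} (g : b ⟶ c) (p d e e' : Fin n → R.obj (op b)) : Prop :=
  ∃ (x y z : M.obj (op b)) (hy : Nbr J R M x y) (hz : Nbr J R M x z), χ.At g p x ∧
    χ.At g (p + d) y ∧ χ.At g (p + e) z ∧ χ.At g (p + d + e') (L.lam x y z hy hz)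

/-- The matrix `F` is the parallel transport from `p` to `p + d`. -/
def TransportsBy {b : C} (g : b ⟶ c) (p d : Fin n → R.obj (op b))
    (F : Matrix (Fin n) (Fin n) (R.obj (op b))) : Prop :=
  ∀ ⦃a : C⦄ (h : a ⟶ b) (e : Fin n → R.obj (op a)), SqZero e →
    χ.Transports L (h ≫ g) (resV R h p) (resV R h d) e ((resM R h F).mulVec e)

variable {χ L} {b : C} {g : b ⟶ c} {p d d' e e' e'' : Fin n → R.obj (op b)}

theorem exists_transports (hp : p ∈ χ.dom g) (hd : SqZero d) (he : SqZero e) :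
    ∃ e', χ.Transports L g p d e e' := by
  obtain ⟨x, hx⟩ := exists_at hp
  obtain ⟨y, hy⟩ := exists_at (mem_dom_add hp hd)
  obtain ⟨z, hz⟩ := exists_at (mem_dom_add hp he)
  obtain ⟨q, hq⟩ := hy.exists_of_nbr (L.nbr_left x y z (hx.nbr hy hd) (hx.nbr hz he))
  exact ⟨q - (p + d), x, y, z, _, _, hx, hy, hz, by rwa [add_sub_cancel]⟩

namespace Transports

theorem at_lam (H : χ.Transports L g p d e e') {x y z : M.obj (op b)} (hx : χ.At g p x)
    (hy : χ.At g (p + d) y) (hz : χ.At g (p + e) z) (hxy : Nbr J R M x y) (hxz : Nbr J R M x z) :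
    χ.At g (p + d + e') (L.lam x y z hxy hxz) := by
  obtain ⟨x', y', z', _, _, hx', hy', hz', H⟩ := H
  obtain rfl := hx.point_eq hx'
  obtain rfl := hy.point_eq hy'
  obtain rfl := hz.point_eq hz'
  exact H

theorem unique (h : χ.Transports L g p d e e') (h' : χ.Transports L g p d e e'') : e' = e'' := by
  obtain ⟨x, y, z, _, _, hx, hy, hz, h⟩ := h
  exact add_left_cancel (h.coord_eq (h'.at_lam hx hy hz _ _))

theorem restrict (H : χ.Transports L g p d e e') {a : C} (h : a ⟶ b) :
    χ.Transports L (h ≫ g) (resV R h p) (resV R h d) (resV R h e) (resV R h e') := by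
  obtain ⟨x, y, z, hxy, hxz, hx, hy, hz, H⟩ := H
  refine ⟨_, _, _, hxy.restrict J R h, hxz.restrict J R h, hx.restrict h, ?_, ?_, ?_⟩
  · exact resV_add h p d ▸ hy.restrict h
  · exact resV_add h p e ▸ hz.restrict h
  · rw [L.natural, ← resV_add, ← resV_add]
    exact H.restrict h

theorem eq_zero (H : χ.Transports L g p d 0 e') : e' = 0 := by
  obtain ⟨x, y, z, hy, hz, hx, hy', hz', H⟩ := H
  rw [add_zero] at hz'
  obtain rfl := hx.point_eq hz'
  rw [L.unit_right] at H
  exact add_eq_left.1 (H.coord_eq hy')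

theorem eq_self (H : χ.Transports L g p 0 e e') : e' = e := by
  obtain ⟨x, y, z, hy, hz, hx, hy', hz', H⟩ := H
  rw [add_zero] at hy' H
  obtain rfl := hx.point_eq hy'
  rw [L.unit_left] at H
  exact add_left_cancel (H.coord_eq hz')

theorem symm (hL : L.Symmetric) (H : χ.Transports L g p d e (e + e')) :
    χ.Transports L g p e d (d + e') := by
  obtain ⟨x, y, z, hy, hz, hx, hy', hz', H⟩ := H
  refine ⟨x, z, y, hz, hy, hx, hz', hy', ?_⟩
  rw [← hL x y z hy hz, add_assoc, add_left_comm e, ← add_assoc]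
  exact H

theorem flat (hL : L.Flat) (hdd' : SqZero (d + d'))
    (H : χ.Transports L g p d e e') (H' : χ.Transports L g (p + d) d' e' e'') :
    χ.Transports L g p (d + d') e e'' := by
  obtain ⟨x, y, t, hxy, hxt, hx, hy, ht, H⟩ := H
  obtain ⟨y', z, t', hyz, _, hy', hz, ht', H'⟩ := H'
  obtain rfl := hy.point_eq hy'
  obtain rfl := H.point_eq ht'
  rw [add_assoc p d d'] at hz H'
  have hxz : Nbr J R M x z := hx.nbr hz hdd'
  rw [hL x y z t hxy hyz hxz hxt] at H'
  exact ⟨x, z, t, hxz, hxt, hx, hz, ht, H'⟩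

end Transports

namespace TransportsBy

variable {F F' : Matrix (Fin n) (Fin n) (R.obj (op b))}

theorem transports (H : χ.TransportsBy L g p d F) (he : SqZero e) :
    χ.Transports L g p d e (F.mulVec e) := by
  simpa only [Category.id_comp, resV_id, resM_id] using H (𝟙 b) e he

theorem restrict (H : χ.TransportsBy L g p d F) {a : C} (h : a ⟶ b) :
    χ.TransportsBy L (h ≫ g) (resV R h p) (resV R h d) (resM R h F) := fun a' l e he => by
  simpa only [resV_resV, resM_resM, Category.assoc] using H (l ≫ h) e he

theorem unique (hKL : FirstOrderKockLawvere R) (H : χ.TransportsBy L g p d F)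
    (H' : χ.TransportsBy L g p d F') : F = F' :=
  hKL.matrix_ext fun _ h e he => (H h e he).unique (H' h e he)

theorem eq_one (hKL : FirstOrderKockLawvere R) (H : χ.TransportsBy L g p 0 F) : F = 1 :=
  hKL.matrix_ext fun _ h e he => by
    have := H h e he
    rw [resV_zero] at this
    rw [this.eq_self, map_one, Matrix.one_mulVec]

theorem flat (hL : L.Flat) (hdd' : SqZero (d + d'))
    (H : χ.TransportsBy L g p d F) (H' : χ.TransportsBy L g (p + d) d' F') :
    χ.TransportsBy L g p (d + d') (F' * F) := fun a h e he => by
  have H'e := H' h _ (he.mulVec (resM R h F))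
  rw [resV_add, Matrix.mulVec_mulVec, ← map_mul] at H'e
  have hdd'h := hdd'.resV h
  rw [resV_add] at hdd'h ⊢
  exact (H h e he).flat hL hdd'h H'e

end TransportsBy

theorem exists_transportsBy (hKL : FirstOrderKockLawvere R) (hp : p ∈ χ.dom g) (hd : SqZero d) :
    ∃ F, χ.TransportsBy L g p d F := by
  obtain ⟨F, hF⟩ := hKL.exists_slope_of_relation
    (P := fun a h e e' => χ.Transports L (h ≫ g) (resV R h p) (resV R h d) e e')
    (fun a h e he => exists_transports (resV_mem_dom h hp) (hd.resV h) he)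
    (fun _ _ _ _ _ H H' => H.unique H')
    (fun a' a l h e e' H => by
      simpa only [resV_resV, Category.assoc] using H.restrict l)
    (v₀ := 0) (by
      obtain ⟨e', H⟩ := exists_transports (L := L) (resV_mem_dom (𝟙 b) hp) (hd.resV (𝟙 b)) .zero
      rwa [H.eq_zero] at H)
  refine ⟨F, fun a h e he => ?_⟩
  have := hF h e he
  rwa [resV_zero, zero_add] at this

theorem exists_christoffel (hKL : FirstOrderKockLawvere R) (L : AffineConnection J R M)
    (hp : p ∈ χ.dom g) :
    ∃ Γ : Fin n → Matrix (Fin n) (Fin n) (R.obj (op b)), ∀ ⦃a : C⦄ (h : a ⟶ b)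
      (d : Fin n → R.obj (op a)), SqZero d →
        χ.TransportsBy L (h ≫ g) (resV R h p) d (1 + matForm (fun i => resM R h (Γ i)) d) := by
  obtain ⟨A, hA⟩ := hKL.exists_slope_of_relation (ι := Fin n × Fin n)
    (P := fun a h d F => χ.TransportsBy L (h ≫ g) (resV R h p) d (Matrix.of fun i j => F (i, j)))
    (fun a h d hd => by
      obtain ⟨F, hF⟩ := exists_transportsBy (L := L) hKL (resV_mem_dom h hp) hd
      exact ⟨fun ij => F ij.1 ij.2, hF⟩)
    (fun _ _ _ _ _ H H' => funext fun ij => congrFun (congrFun (H.unique hKL H') ij.1) ij.2)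
    (fun a' a l h d F H => by
      have := H.restrict l
      rwa [resV_resV, ← Category.assoc] at this)
    (v₀ := fun ij => (1 : Matrix (Fin n) (Fin n) (R.obj (op b))) ij.1 ij.2) (by
      obtain ⟨F, H⟩ := exists_transportsBy (L := L) hKL (resV_mem_dom (𝟙 b) hp) .zero
      rwa [H.eq_one hKL] at H)
  refine ⟨fun k => .of fun i j => A (i, j) k, fun a h d hd => ?_⟩
  convert hA h d hd using 1
  ext i j
  simp [matForm_apply, Matrix.sum_apply, Matrix.mulVec, dotProduct, Matrix.one_apply, mul_comm,
    apply_ite]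

/-- The family `Γ` of matrices consists of the Christoffel symbols of the connection `L` in the
chart `χ`: it is natural, and `λ(p, p + d, p + e) = p + d + e + Γ_p(d) e`. -/
structure IsChristoffel (χ : Chart J R M n c) (L : AffineConnection J R M)
    (Γ : ∀ ⦃b : C⦄, (b ⟶ c) → (Fin n → R.obj (op b)) →
      Fin n → Matrix (Fin n) (Fin n) (R.obj (op b))) : Prop where
  natural : ∀ ⦃a b : C⦄ (h : a ⟶ b) {g : b ⟶ c} {p : Fin n → R.obj (op b)}, p ∈ χ.dom g →
    Γ (h ≫ g) (resV R h p) = fun i => resM R h (Γ g p i)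
  transportsBy : ∀ ⦃b : C⦄ {g : b ⟶ c} {p d : Fin n → R.obj (op b)}, p ∈ χ.dom g → SqZero d →
    χ.TransportsBy L g p d (1 + matForm (Γ g p) d)

theorem exists_isChristoffel (hKL : FirstOrderKockLawvere R) (χ : Chart J R M n c)
    (L : AffineConnection J R M) : ∃ Γ, χ.IsChristoffel L Γ := by
  choose! Γ hΓ using fun (b : C) (g : b ⟶ c) (p : Fin n → R.obj (op b)) (hp : p ∈ χ.dom g) =>
    exists_christoffel hKL L hp
  refine ⟨Γ, fun a b h g p hp => hKL.matForm_injective fun a' l d hd => ?_, fun b g p d hp hd => ?_⟩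
  · have H := hΓ a (h ≫ g) _ (resV_mem_dom h hp) l d hd
    have H' := hΓ b g p hp (l ≫ h) d hd
    rw [resV_resV, ← Category.assoc] at H
    simpa only [resM_resM, add_right_inj] using H.unique hKL H'
  · simpa only [Category.id_comp, resV_id, resM_id] using hΓ b g p hp (𝟙 b) d hd

/-- At the point `p`, the partial derivative of `Γ i` in the direction `m` is `D m i`. -/
def HasDerivAt (Γ : ∀ ⦃b : C⦄, (b ⟶ c) → (Fin n → R.obj (op b)) →
      Fin n → Matrix (Fin n) (Fin n) (R.obj (op b)))
    (D : Fin n → Fin n → Matrix (Fin n) (Fin n) (R.obj (op b))) (g : b ⟶ c)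
    (p : Fin n → R.obj (op b)) : Prop :=
  ∀ ⦃a : C⦄ (h : a ⟶ b) (d : Fin n → R.obj (op a)), SqZero d →
    Γ (h ≫ g) (resV R h p + d) =
      fun i => Γ (h ≫ g) (resV R h p) i + ∑ m, d m • resM R h (D m i)

namespace IsChristoffel

variable {Γ : ∀ ⦃b : C⦄, (b ⟶ c) → (Fin n → R.obj (op b)) →
    Fin n → Matrix (Fin n) (Fin n) (R.obj (op b))}
  {D : Fin n → Fin n → Matrix (Fin n) (Fin n) (R.obj (op b))}

theorem resM_matForm (hΓ : χ.IsChristoffel L Γ) {a : C} (h : a ⟶ b) (hp : p ∈ χ.dom g)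
    (d : Fin n → R.obj (op b)) :
    resM R h (matForm (Γ g p) d) = matForm (Γ (h ≫ g) (resV R h p)) (resV R h d) := by
  rw [SDG.resM_matForm, hΓ.natural h hp]

theorem symm (hΓ : χ.IsChristoffel L Γ) (hsymm : L.Symmetric) (hp : p ∈ χ.dom g) (hd : SqZero d)
    (he : SqZero e) : (matForm (Γ g p) d).mulVec e = (matForm (Γ g p) e).mulVec d := by
  have H := (hΓ.transportsBy hp hd).transports he
  have H' := (hΓ.transportsBy hp he).transports hd
  rw [Matrix.add_mulVec, Matrix.one_mulVec] at H H'
  exact add_left_cancel ((H.symm hsymm).unique H')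

theorem exists_hasDerivAt (hΓ : χ.IsChristoffel L Γ) (hKL : FirstOrderKockLawvere R)
    (hp : p ∈ χ.dom g) : ∃ D, HasDerivAt Γ D g p := by
  choose D hD _ using fun i j k => hKL n b (fun a h d _ => Γ (h ≫ g) (resV R h p + d) i j k)
    fun a' a l h d hd => by
      have := congrFun (hΓ.natural l (mem_dom_add (resV_mem_dom h hp) hd)) i
      rw [resV_add, resV_resV, ← Category.assoc] at this
      rw [this]
      rfl
  refine ⟨fun m i j k => D i j k m, fun a h d hd => funext fun i => ?_⟩
  ext j k
  rw [hD i j k h d hd, add_zero, dotProduct_comm, Matrix.add_apply, Matrix.sum_apply]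
  rfl

theorem mul_of_mutual_nbrs (hΓ : χ.IsChristoffel L Γ) (hKL : FirstOrderKockLawvere R)
    (hflat : L.Flat) (hp : p ∈ χ.dom g) (hd : SqZero d) (hd' : SqZero d')
    (hdd' : SqZero (d + d')) :
    (1 + matForm (Γ g (p + d)) d') * (1 + matForm (Γ g p) d) = 1 + matForm (Γ g p) (d + d') :=
  ((hΓ.transportsBy hp hd).flat hflat hdd' (hΓ.transportsBy (mem_dom_add hp hd) hd')).unique
    hKL (hΓ.transportsBy hp hdd')

theorem curvature_eq_zero (hΓ : χ.IsChristoffel L Γ) (hKL : FirstOrderKockLawvere R)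
    (hflat : L.Flat) (hp : p ∈ χ.dom g) (hD : HasDerivAt Γ D g p) (i j : Fin n) :
    D i j + Γ g p j * Γ g p i = D j i + Γ g p i * Γ g p j := by
  refine sub_eq_zero.1 (Matrix.ext fun k l => ?_)
  refine hKL.eq_zero_of_mul_prod_sqZero (k := 4) fun a h s hs => ?_
  have hsum := prod_smul_sub_eq_zero_of_mutual_nbrs
    (B := fun i j => resM R h (D i j + Γ g p j * Γ g p i)) (fun d d' hd hd' hdd' => ?_) i j hs
  · rw [← map_sub] at hsum
    rw [mul_comm]
    exact congrFun (congrFun hsum k) l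
  · have := hΓ.mul_of_mutual_nbrs hKL hflat (resV_mem_dom h hp) hd hd' hdd'
    rw [hD h d hd, one_add_matForm_mul _ _ hd, add_eq_left] at this
    simpa only [map_add, map_mul, hΓ.natural h hp] using this

theorem mul_comm_of_flat (hΓ : χ.IsChristoffel L Γ) (hKL : FirstOrderKockLawvere R)
    (hflat : L.Flat) (hp : p ∈ χ.dom g) (hd : SqZero d) (he : SqZero e) :
    (1 + matForm (Γ g (p + d)) e) * (1 + matForm (Γ g p) d) =
      (1 + matForm (Γ g (p + e)) d) * (1 + matForm (Γ g p) e) := by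
  obtain ⟨D, hD⟩ := hΓ.exists_hasDerivAt hKL hp
  have hD' := hD (𝟙 b)
  simp only [Category.id_comp, resV_id, resM_id] at hD'
  rw [hD' d hd, hD' e he, one_add_matForm_mul _ _ hd, one_add_matForm_mul _ _ he, add_comm d,
    Finset.sum_comm]
  congr! 3 with i _ j
  rw [hΓ.curvature_eq_zero hKL hflat hp hD j i, mul_comm]

theorem matForm_add_point (hΓ : χ.IsChristoffel L Γ) (hKL : FirstOrderKockLawvere R)
    (hp : p ∈ χ.dom g) (hd : SqZero d) (hde : ∀ i j, d i * e j = 0) :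
    matForm (Γ g (p + d)) e = matForm (Γ g p) e := by
  obtain ⟨D, hD⟩ := hΓ.exists_hasDerivAt hKL hp
  have hD' := hD (𝟙 b) d hd
  simp only [Category.id_comp, resV_id] at hD'
  simp only [hD', matForm_deriv, hde, zero_smul, Finset.sum_const_zero, add_zero]

end IsChristoffel

end Chart

end Christoffel

section Development

variable {C : Type u} [Category.{v} C] {J : GrothendieckTopology C}
  {R : Cᵒᵖ ⥤ CommAlgCat.{w} ℚ} {M : Cᵒᵖ ⥤ Type w'} {n : ℕ} {c : C}

variable (J R) in
/-- Points which are joined by a finite path of neighbours at the given stage. -/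
def Linked (X : Cᵒᵖ ⥤ Type w') {c : C} (x y : X.obj (op c)) : Prop :=
  Relation.ReflTransGen (fun p q : X.obj (op c) => Nbr J R X p q) x y

/-- A map to an abelian group is an affine coordinate system around `x₀` if it is injective on the
points linked to `x₀` and takes `λ(x, y, z)` to `y - x + z`. -/
structure IsAffineCoord (L : AffineConnection J R M) {c : C} (x₀ : M.obj (op c)) {V : Type*}
    [AddCommGroup V] (φ : M.obj (op c) → V) : Prop where
  inj : ∀ ⦃y z : M.obj (op c)⦄, Linked J R M x₀ y → Linked J R M x₀ z → φ y = φ z → y = z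
  map_lam : ∀ ⦃x y z : M.obj (op c)⦄ (hy : Nbr J R M x y) (hz : Nbr J R M x z),
    Linked J R M x₀ x → φ (L.lam x y z hy hz) = φ y - φ x + φ z

/-- The parallel transport `1 + Γ d` along `d` as a unit, with inverse `1 - Γ d`. -/
def SqZero.transport {A : Type*} [CommRing A] {d : Fin n → A} (hd : SqZero d)
    (Γ : Fin n → Matrix (Fin n) (Fin n) A) : (Matrix (Fin n) (Fin n) A)ˣ where
  val := 1 + matForm Γ d
  inv := 1 - matForm Γ d
  val_inv := hd.one_add_mul_one_sub Γ
  inv_val := hd.one_sub_mul_one_add Γ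

@[simp]
theorem SqZero.coe_transport {A : Type*} [CommRing A] {d : Fin n → A} (hd : SqZero d)
    (Γ : Fin n → Matrix (Fin n) (Fin n) A) : (hd.transport Γ).1 = 1 + matForm Γ d :=
  rfl

@[simp]
theorem SqZero.coe_inv_transport {A : Type*} [CommRing A] {d : Fin n → A} (hd : SqZero d)
    (Γ : Fin n → Matrix (Fin n) (Fin n) A) : (hd.transport Γ)⁻¹.1 = 1 - matForm Γ d :=
  rfl

namespace Chart

theorem IsChristoffel.transport_mul_transport {χ : Chart J R M n c} {L : AffineConnection J R M}
    {Γ : ∀ ⦃b : C⦄, (b ⟶ c) → (Fin n → R.obj (op b)) →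
      Fin n → Matrix (Fin n) (Fin n) (R.obj (op b))} (hΓ : χ.IsChristoffel L Γ)
    (hKL : FirstOrderKockLawvere R) {b : C} {g : b ⟶ c} {p d e : Fin n → R.obj (op b)}
    (hp : p ∈ χ.dom g) (hd : SqZero d) :
    (1 + matForm (Γ g (p + d)) ((1 + matForm (Γ g p) d).mulVec e)) * (1 + matForm (Γ g p) d) =
      (1 + matForm (Γ g (p + d)) e) * (1 + matForm (Γ g p) d) +
        matForm (Γ g p) ((matForm (Γ g p) d).mulVec e) := by
  have h0 : ∀ i j, (matForm (Γ g p) d).mulVec e i * d j = 0 := matForm_mulVec_mul_eq_zero _ hd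
  rw [Matrix.add_mulVec, Matrix.one_mulVec, map_add, ← add_assoc, add_mul,
    hΓ.matForm_add_point hKL hp hd fun i j => (mul_comm ..).trans (h0 j i), mul_add (matForm _ _),
    matForm_mul_matForm_eq_zero _ _ h0, mul_one, add_zero]

/-- A moving frame in a chart: the coordinates of the end point of a path, the parallel transport
along the path, and the development of the path into the tangent space at its starting point. -/
@[ext]
structure MovingFrame (χ : Chart J R M n c) {b : C} (g : b ⟶ c) where
  point : Fin n → R.obj (op b)
  frame : (Matrix (Fin n) (Fin n) (R.obj (op b)))ˣ
  position : Fin n → R.obj (op b)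
  mem_dom : point ∈ χ.dom g

namespace MovingFrame

variable {χ : Chart J R M n c} {a b : C} {g : b ⟶ c}

/-- Restriction of moving frames along `h`. -/
def res (h : a ⟶ b) {g' : a ⟶ c} (w : h ≫ g = g') (s : χ.MovingFrame g) :
    χ.MovingFrame g' where
  point := resV R h s.point
  frame := Units.map (resM R h).toMonoidHom s.frame
  position := resV R h s.position
  mem_dom := w ▸ resV_mem_dom h s.mem_dom

/-- The presheaf of moving frames of a chart, over its stage of definition. -/
abbrev presheaf (χ : Chart J R M n c) : (Over c)ᵒᵖ ⥤ Type w where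
  obj U := χ.MovingFrame U.unop.hom
  map h := ↾MovingFrame.res h.unop.left (Over.w h.unop)
  map_id _ := ConcreteCategory.hom_ext _ _ fun _ =>
    MovingFrame.ext (resV_id _) (Units.ext (resM_id _)) (resV_id _)
  map_comp _ _ := ConcreteCategory.hom_ext _ _ fun _ =>
    MovingFrame.ext (resV_resV ..).symm (Units.ext (resM_resM ..).symm) (resV_resV ..).symm

variable {L : AffineConnection J R M}
  {Γ : ∀ ⦃b : C⦄, (b ⟶ c) → (Fin n → R.obj (op b)) →
    Fin n → Matrix (Fin n) (Fin n) (R.obj (op b))}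
  {d e : Fin n → R.obj (op b)}

variable (Γ) in
/-- Continuation of a moving frame along the displacement `d` of its point. -/
def moveBy (s : χ.MovingFrame g) (hd : SqZero d) : χ.MovingFrame g where
  point := s.point + d
  frame := hd.transport (Γ g s.point) * s.frame
  position := s.position + s.frame⁻¹.1.mulVec d
  mem_dom := mem_dom_add s.mem_dom hd

theorem moveBy_zero (s : χ.MovingFrame g) : s.moveBy Γ .zero = s :=
  MovingFrame.ext (add_zero _) (Units.ext (by simp [moveBy])) (by simp [moveBy])

theorem res_moveBy (hΓ : χ.IsChristoffel L Γ) (s : χ.MovingFrame g) (hd : SqZero d) (h : a ⟶ b)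
    {g' : a ⟶ c} (w : h ≫ g = g') :
    (s.moveBy Γ hd).res h w = (s.res h w).moveBy Γ (hd.resV h) := by
  subst w
  refine MovingFrame.ext (resV_add ..) (Units.ext ?_) ?_
  · change resM R h ((1 + matForm _ d) * s.frame.1) = _
    rw [map_mul, map_add, map_one, hΓ.resM_matForm h s.mem_dom]
    rfl
  · change resV R h (s.position + s.frame⁻¹.1.mulVec d) = _
    rw [resV_add, resV_mulVec]
    rfl

theorem moveBy_comm (hΓ : χ.IsChristoffel L Γ) (hKL : FirstOrderKockLawvere R)
    (hsymm : L.Symmetric) (hflat : L.Flat) (s : χ.MovingFrame g) (hd : SqZero d) (he : SqZero e) :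
    (s.moveBy Γ hd).moveBy Γ he = (s.moveBy Γ he).moveBy Γ hd := by
  refine MovingFrame.ext (add_right_comm ..) (Units.ext ?_) ?_
  · simp [moveBy, ← mul_assoc, hΓ.mul_comm_of_flat hKL hflat s.mem_dom hd he]
  · simp only [moveBy, mul_inv_rev, Units.val_mul, SqZero.coe_inv_transport]
    rw [add_assoc, add_assoc, ← Matrix.mulVec_mulVec, ← Matrix.mulVec_mulVec, ← Matrix.mulVec_add,
      ← Matrix.mulVec_add, Matrix.sub_mulVec, Matrix.sub_mulVec, hΓ.symm hsymm s.mem_dom hd he,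
      Matrix.one_mulVec, Matrix.one_mulVec, add_sub_left_comm]

variable (Γ) in
/-- Continuation of a moving frame along the displacement `d` of its position: the vector `d` at
the starting point is transported to the current point. -/
def develop (s : χ.MovingFrame g) (hd : SqZero d) : χ.MovingFrame g :=
  s.moveBy Γ (hd.mulVec s.frame.1)

theorem position_develop (s : χ.MovingFrame g) (hd : SqZero d) :
    (s.develop Γ hd).position = s.position + d := by
  simp only [develop, moveBy, Matrix.mulVec_mulVec, Units.inv_mul, Matrix.one_mulVec]

theorem develop_zero (s : χ.MovingFrame g) : s.develop Γ .zero = s := by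
  simp only [develop, Matrix.mulVec_zero, moveBy_zero]

theorem res_develop (hΓ : χ.IsChristoffel L Γ) (s : χ.MovingFrame g) (hd : SqZero d) (h : a ⟶ b)
    {g' : a ⟶ c} (w : h ≫ g = g') :
    (s.develop Γ hd).res h w = (s.res h w).develop Γ (hd.resV h) := by
  simp only [develop, res_moveBy hΓ, resV_mulVec]
  rfl

theorem develop_inv_mulVec (s : χ.MovingFrame g) (hd : SqZero d) :
    s.develop Γ (hd.mulVec s.frame⁻¹.1) = s.moveBy Γ hd := by
  simp only [develop, Matrix.mulVec_mulVec, Units.mul_inv, Matrix.one_mulVec]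

theorem develop_comm (hΓ : χ.IsChristoffel L Γ) (hKL : FirstOrderKockLawvere R)
    (hsymm : L.Symmetric) (hflat : L.Flat) (s : χ.MovingFrame g) (hd : SqZero d) (he : SqZero e) :
    (s.develop Γ hd).develop Γ he = (s.develop Γ he).develop Γ hd := by
  have hd' := hd.mulVec s.frame.1
  have he' := he.mulVec s.frame.1
  have hde := hΓ.symm hsymm s.mem_dom hd' he'
  refine MovingFrame.ext ?_ (Units.ext ?_) ?_
  · simp only [develop, moveBy, Units.val_mul, SqZero.coe_transport, ← Matrix.mulVec_mulVec,
      Matrix.add_mulVec, Matrix.one_mulVec, hde]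
    abel
  · simp only [develop, moveBy, Units.val_mul, SqZero.coe_transport, ← Matrix.mulVec_mulVec,
      ← mul_assoc]
    rw [hΓ.transport_mul_transport hKL s.mem_dom hd', hΓ.transport_mul_transport hKL s.mem_dom he',
      hΓ.mul_comm_of_flat hKL hflat s.mem_dom hd' he', hde]
  · rw [position_develop, position_develop, position_develop, position_develop, add_right_comm]

end MovingFrame

namespace IsChristoffel

variable {χ : Chart J R M n c} {L : AffineConnection J R M}
  {Γ : ∀ ⦃b : C⦄, (b ⟶ c) → (Fin n → R.obj (op b)) →
    Fin n → Matrix (Fin n) (Fin n) (R.obj (op b))}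

/-- Moving frames, with the steps measured in the coordinate space. -/
def pointSteps (hΓ : χ.IsChristoffel L Γ) : StepSystem R n c where
  State := MovingFrame.presheaf χ
  step _ s _ hd := s.moveBy Γ hd
  step_zero _ s := s.moveBy_zero
  res_step _ _ h s _ hd := s.res_moveBy hΓ hd h.left (Over.w h)

/-- Moving frames, with the steps measured in the tangent space at the starting point. -/
def positionSteps (hΓ : χ.IsChristoffel L Γ) : StepSystem R n c where
  State := MovingFrame.presheaf χ
  step _ s _ hd := s.develop Γ hd
  step_zero _ s := s.develop_zero
  res_step _ _ h s _ hd := s.res_develop hΓ hd h.left (Over.w h)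

theorem pointSteps_commutes (hΓ : χ.IsChristoffel L Γ) (hKL : FirstOrderKockLawvere R)
    (hsymm : L.Symmetric) (hflat : L.Flat) : hΓ.pointSteps.Commutes :=
  fun _ s _ _ hd he => s.moveBy_comm hΓ hKL hsymm hflat hd he

theorem positionSteps_commutes (hΓ : χ.IsChristoffel L Γ) (hKL : FirstOrderKockLawvere R)
    (hsymm : L.Symmetric) (hflat : L.Flat) : hΓ.positionSteps.Commutes :=
  fun _ s _ _ hd he => s.develop_comm hΓ hKL hsymm hflat hd he

/-- The moving frame `s` is the result of moving `s₀` along some path. -/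
structure Develops (hΓ : χ.IsChristoffel L Γ) (s₀ s : χ.MovingFrame (𝟙 c)) : Prop where
  reaches_point : hΓ.pointSteps.Reaches s₀ (s.point - s₀.point) s
  reaches_position : hΓ.positionSteps.Reaches s₀ (s.position - s₀.position) s

namespace Develops

variable {hΓ : χ.IsChristoffel L Γ} {s₀ s s' : χ.MovingFrame (𝟙 c)}

theorem refl : hΓ.Develops s₀ s₀ where
  reaches_point := (sub_self s₀.point).symm ▸ .refl
  reaches_position := (sub_self s₀.position).symm ▸ .refl

theorem moveBy (h : hΓ.Develops s₀ s) {d : Fin n → R.obj (op c)} (hd : SqZero d) :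
    hΓ.Develops s₀ (s.moveBy Γ hd) where
  reaches_point := by
    have := h.reaches_point.step d hd
    rwa [sub_add_eq_add_sub] at this
  reaches_position := by
    have := h.reaches_position.step _ (hd.mulVec s.frame⁻¹.1)
    rw [sub_add_eq_add_sub] at this
    rwa [← s.develop_inv_mulVec, s.position_develop]

theorem position_eq (hKL : FirstOrderKockLawvere R) (hsymm : L.Symmetric) (hflat : L.Flat)
    (h : hΓ.Develops s₀ s) (h' : hΓ.Develops s₀ s') (hp : s.point = s'.point) :
    s.position = s'.position :=
  funext fun i => h.reaches_point.apply_eq_apply hKL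
    (hΓ.pointSteps_commutes hKL hsymm hflat) (hp ▸ h'.reaches_point)
    ⟨fun _ (t : χ.MovingFrame _) => t.position i, fun _ _ _ _ => rfl⟩

theorem point_eq (hKL : FirstOrderKockLawvere R) (hsymm : L.Symmetric) (hflat : L.Flat)
    (h : hΓ.Develops s₀ s) (h' : hΓ.Develops s₀ s') (hp : s.position = s'.position) :
    s.point = s'.point :=
  funext fun i => h.reaches_position.apply_eq_apply hKL
    (hΓ.positionSteps_commutes hKL hsymm hflat) (hp ▸ h'.reaches_position)
    ⟨fun _ (t : χ.MovingFrame _) => t.point i, fun _ _ _ _ => rfl⟩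

end Develops

/-- The point `y` has the affine coordinate `η`: some path from the point of `s₀` to `y` develops
into a path from the position of `s₀` to `η`. -/
def HasPosition (hΓ : χ.IsChristoffel L Γ) (s₀ : χ.MovingFrame (𝟙 c)) (y : M.obj (op c))
    (η : Fin n → R.obj (op c)) : Prop :=
  ∃ s, hΓ.Develops s₀ s ∧ χ.At (𝟙 c) s.point y ∧ s.position = η

namespace HasPosition

variable {hΓ : χ.IsChristoffel L Γ} {s₀ : χ.MovingFrame (𝟙 c)} {x y z : M.obj (op c)}
  {ξ η ζ : Fin n → R.obj (op c)}

theorem unique (hKL : FirstOrderKockLawvere R) (hsymm : L.Symmetric) (hflat : L.Flat)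
    (h : hΓ.HasPosition s₀ y η) (h' : hΓ.HasPosition s₀ y ζ) : η = ζ := by
  obtain ⟨s, hs, hy, rfl⟩ := h
  obtain ⟨s', hs', hy', rfl⟩ := h'
  exact hs.position_eq hKL hsymm hflat hs' (hy.coord_eq hy')

theorem point_eq (hKL : FirstOrderKockLawvere R) (hsymm : L.Symmetric) (hflat : L.Flat)
    (h : hΓ.HasPosition s₀ y η) (h' : hΓ.HasPosition s₀ z η) : y = z := by
  obtain ⟨s, hs, hy, rfl⟩ := h
  obtain ⟨s', hs', hz, hη⟩ := h'
  exact hy.point_eq (hs.point_eq hKL hsymm hflat hs' hη.symm ▸ hz)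

theorem lam (hR : Presieve.IsSeparated J (R ⋙ forget (CommAlgCat ℚ)))
    (hKL : FirstOrderKockLawvere R) (hsymm : L.Symmetric) (hflat : L.Flat)
    (hξ : hΓ.HasPosition s₀ x ξ) (hη : hΓ.HasPosition s₀ y η) (hζ : hΓ.HasPosition s₀ z ζ)
    (hy : Nbr J R M x y) (hz : Nbr J R M x z) :
    hΓ.HasPosition s₀ (L.lam x y z hy hz) (η - ξ + ζ) := by
  obtain ⟨s, hs, hx, rfl⟩ := hξ
  obtain ⟨d, hd, hyd⟩ := hx.exists_add_of_nbr hR hKL hy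
  obtain ⟨e, he, hze⟩ := hx.exists_add_of_nbr hR hKL hz
  obtain rfl := hη.unique hKL hsymm hflat ⟨_, hs.moveBy hd, hyd, rfl⟩
  obtain rfl := hζ.unique hKL hsymm hflat ⟨_, hs.moveBy he, hze, rfl⟩
  have hw := ((hΓ.transportsBy hx.mem_dom hd).transports he).at_lam hx hyd hze hy hz
  refine ⟨_, (hs.moveBy hd).moveBy (he.mulVec _), hw, ?_⟩
  simp only [MovingFrame.moveBy, mul_inv_rev, Units.val_mul, SqZero.coe_inv_transport]
  rw [Matrix.mulVec_mulVec, mul_assoc, hd.one_sub_mul_one_add, mul_one]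
  abel

end HasPosition

theorem exists_hasPosition (hR : Presieve.IsSeparated J (R ⋙ forget (CommAlgCat ℚ)))
    (hKL : FirstOrderKockLawvere R) (hΓ : χ.IsChristoffel L Γ) {s₀ : χ.MovingFrame (𝟙 c)}
    {x₀ y : M.obj (op c)} (hx₀ : χ.At (𝟙 c) s₀.point x₀) (hy : Linked J R M x₀ y) :
    ∃ η, hΓ.HasPosition s₀ y η := by
  induction hy with
  | refl => exact ⟨_, s₀, .refl, hx₀, rfl⟩
  | tail _ hyz ih =>
    obtain ⟨_, s, hs, hy, -⟩ := ih
    obtain ⟨d, hd, hz⟩ := hy.exists_add_of_nbr hR hKL hyz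
    exact ⟨_, _, hs.moveBy hd, hz, rfl⟩

end IsChristoffel

theorem At.exists_isAffineCoord (hR : Presieve.IsSeparated J (R ⋙ forget (CommAlgCat ℚ)))
    (hKL : FirstOrderKockLawvere R) {L : AffineConnection J R M} (hsymm : L.Symmetric)
    (hflat : L.Flat) {χ : Chart J R M n c} {p₀ : Fin n → R.obj (op c)} {x₀ : M.obj (op c)}
    (hx₀ : χ.At (𝟙 c) p₀ x₀) : ∃ φ : M.obj (op c) → Fin n → R.obj (op c), IsAffineCoord L x₀ φ := by
  obtain ⟨Γ, hΓ⟩ := exists_isChristoffel hKL χ L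
  let s₀ : χ.MovingFrame (𝟙 c) := ⟨p₀, 1, 0, hx₀.mem_dom⟩
  choose! φ hφ using fun y (hy : Linked J R M x₀ y) =>
    hΓ.exists_hasPosition hR hKL (s₀ := s₀) hx₀ hy
  refine ⟨φ, fun y z hy hz hyz => ?_, fun x y z hy hz hx => ?_⟩
  · exact (hφ y hy).point_eq hKL hsymm hflat (hyz ▸ hφ z hz)
  · refine (hφ _ ((hx.tail hy).tail (L.nbr_left x y z hy hz))).unique hKL hsymm hflat ?_
    exact (hφ x hx).lam hR hKL hsymm hflat (hφ y (hx.tail hy)) (hφ z (hx.tail hz)) hy hz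

end Chart

end Development

section SumOne

theorem sum_one_induction {ι : Type*} [Fintype ι] [DecidableEq ι] {P : (ι → ℤ) → Prop}
    (single : ∀ i, P (Pi.single i 1)) (sub_add : ∀ a b c, P a → P b → P c → P (a - b + c))
    {a : ι → ℤ} (ha : ∑ i, a i = 1) : P a := by
  obtain ⟨o⟩ : Nonempty ι := by
    by_contra! h
    simp at ha
  let translations : AddSubgroup (ι → ℤ) :=
    { carrier := {k | ∀ b, P b → P (b + k) ∧ P (b - k)}
      zero_mem' := fun b hb => by simpa using hb
      add_mem' := fun {k l} hk hl b hb =>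
        ⟨add_assoc b k l ▸ (hl _ (hk b hb).1).1, sub_sub b k l ▸ (hl _ (hk b hb).2).2⟩
      neg_mem' := fun {k} hk b hb =>
        ⟨sub_eq_add_neg b k ▸ (hk b hb).2, (sub_neg_eq_add b k).symm ▸ (hk b hb).1⟩ }
  have single_sub_mem (i : ι) : Pi.single i 1 - Pi.single o 1 ∈ translations := fun b hb =>
    ⟨by simpa [sub_add_eq_add_sub, add_sub_assoc] using
      sub_add _ _ _ hb (single o) (single i), by
      simpa [sub_sub_eq_add_sub, sub_add_eq_add_sub] using sub_add _ _ _ hb (single i) (single o)⟩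
  have mem := translations.sum_mem fun i (_ : i ∈ Finset.univ) =>
    translations.zsmul_mem (single_sub_mem i) (a i)
  have h := (mem _ (single o)).1
  simp only [smul_sub, Finset.sum_sub_distrib, ← Finset.sum_smul, ha, one_smul,
    add_sub_cancel] at h
  rwa [show ∑ i, a i • Pi.single i (1 : ℤ) = a from (pi_eq_sum_univ' a).symm] at h

theorem sum_sub_add_eq_one {A ι : Type*} [Ring A] [Fintype ι] {a b c : ι → A}
    (ha : ∑ i, a i = 1) (hb : ∑ i, b i = 1) (hc : ∑ i, c i = 1) : ∑ i, (a - b + c) i = 1 := by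
  simp [Finset.sum_add_distrib, Finset.sum_sub_distrib, ha, hb, hc]

end SumOne

namespace AffineSpaceStructure

variable {A X : Type*} [CommRing A] (S : AffineSpaceStructure A X)

theorem comb_congr {n : ℕ} {a b : Fin n → A} (h : a = b) (ha : ∑ i, a i = 1)
    (hb : ∑ i, b i = 1) (x : Fin n → X) : S.comb a ha x = S.comb b hb x := by
  subst h
  rfl

/-- The affine combination `y - x + z`. -/
def tern (y x z : X) : X :=
  S.comb ![1, -1, 1] (by simp [Fin.sum_univ_succ]) ![y, x, z]

theorem tern_comb {n : ℕ} {a b c : Fin n → A} (ha : ∑ i, a i = 1) (hb : ∑ i, b i = 1)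
    (hc : ∑ i, c i = 1) (x : Fin n → X) :
    S.tern (S.comb a ha x) (S.comb b hb x) (S.comb c hc x) =
      S.comb (a - b + c) (sum_sub_add_eq_one ha hb hc) x := by
  have hB : ∀ i, ∑ j, (![a, b, c] : Fin 3 → Fin n → A) i j = 1 := by
    simp [Fin.forall_fin_succ, ha, hb, hc]
  have hsum : a - b + c = fun j => ∑ i, (![1, -1, 1] : Fin 3 → A) i * ![a, b, c] i j := by
    funext j
    simp only [Pi.add_apply, Pi.sub_apply, Fin.sum_univ_three, Matrix.cons_val]
    ring
  rw [S.comb_congr hsum _ (hsum ▸ sum_sub_add_eq_one ha hb hc),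
    ← S.comb_comb _ _ x (by simp [Fin.sum_univ_succ]) hB, tern]
  congr 1
  funext i
  fin_cases i <;> rfl

theorem tern_eq_comb {n : ℕ} (x : Fin n → X) (i j k : Fin n) :
    S.tern (x i) (x j) (x k) = S.comb (Pi.single i 1 - Pi.single j 1 + Pi.single k 1)
      (sum_sub_add_eq_one (by simp) (by simp) (by simp)) x := by
  rw [← S.tern_comb (by simp) (by simp) (by simp), S.comb_single, S.comb_single, S.comb_single]

theorem tern_self_right (y x : X) : S.tern y x x = y := by
  refine (S.tern_eq_comb ![y, x] 0 1 1).trans ?_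
  rw [S.comb_congr (sub_add_cancel _ _) _ (by simp), S.comb_single]
  rfl

theorem tern_self_left (x z : X) : S.tern x x z = z := by
  refine (S.tern_eq_comb ![x, z] 0 0 1).trans ?_
  rw [S.comb_congr (b := Pi.single 1 1) (by rw [sub_self, zero_add]) _ (by simp), S.comb_single]
  rfl

theorem tern_tern_left (y x z z' : X) : S.tern (S.tern y x z) z z' = S.tern y x z' := by
  let p := ![y, x, z, z']
  change S.tern (S.tern (p 0) (p 1) (p 2)) (p 2) (p 3) = S.tern (p 0) (p 1) (p 3)
  rw [S.tern_eq_comb p 0 1 2, S.tern_eq_comb p 0 1 3, ← S.comb_single 2 p (by simp),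
    ← S.comb_single 3 p (by simp), S.tern_comb]
  exact S.comb_congr (by rw [add_sub_cancel_right]) _ _ p

theorem tern_tern_right (y x x' z : X) : S.tern y x' (S.tern x' x z) = S.tern y x z := by
  let p := ![y, x, x', z]
  change S.tern (p 0) (p 2) (S.tern (p 2) (p 1) (p 3)) = S.tern (p 0) (p 1) (p 3)
  rw [S.tern_eq_comb p 2 1 3, S.tern_eq_comb p 0 1 3, ← S.comb_single 0 p (by simp),
    ← S.comb_single 2 p (by simp), S.tern_comb]
  exact S.comb_congr (by abel) _ _ p

theorem ext_of_tern {S T : AffineSpaceStructure ℤ X}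
    (h : ∀ y x z, S.tern y x z = T.tern y x z) : S = T := by
  have comb_eq {n : ℕ} (a : Fin n → ℤ) (ha : ∑ i, a i = 1) (x : Fin n → X) :
      S.comb a ha x = T.comb a ha x := by
    obtain ⟨_, h⟩ := sum_one_induction (P := fun a => ∃ ha, S.comb a ha x = T.comb a ha x)
      (fun i => ⟨by simp, by rw [S.comb_single, T.comb_single]⟩)
      (fun a b c ⟨ha, hSa⟩ ⟨hb, hSb⟩ ⟨hc, hSc⟩ => ⟨sum_sub_add_eq_one ha hb hc, by
        rw [← S.tern_comb ha hb hc, ← T.tern_comb ha hb hc, h, hSa, hSb, hSc]⟩) ha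
    exact h
  cases S
  cases T
  congr 1
  funext n a ha x
  exact comb_eq a ha x

end AffineSpaceStructure

section Parallelograms

/-- Subdivision of a parallelogram spanned by two paths into elementary parallelograms; `Q y x z w`
stands for `w = y - x + z`. -/
theorem exists_parallelogram {X : Type*} {r : X → X → Prop} {Q : X → X → X → X → Prop}
    (self_right : ∀ y x, Q y x x y) (self_left : ∀ x z, Q x x z z)
    (base : ∀ ⦃x y z⦄, r x y → r x z → ∃ w, r y w ∧ r z w ∧ Q y x z w)
    (trans_left : ∀ ⦃y x z z' u w⦄, Q y x z u → Q u z z' w → Q y x z' w)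
    (trans_right : ∀ ⦃y x x' z u w⦄, Q x' x z u → Q y x' u w → Q y x z w) {x y z : X}
    (hy : Relation.ReflTransGen r x y) (hz : Relation.ReflTransGen r x z) : ∃ w, Q y x z w := by
  have strip ⦃x x' z : X⦄ (hx' : r x x') (hz : Relation.ReflTransGen r x z) :
      ∃ w, r z w ∧ Relation.ReflTransGen r x' w ∧ Q x' x z w := by
    induction hz with
    | refl => exact ⟨x', hx', .refl, self_right x' x⟩
    | tail _ hz ih =>
      obtain ⟨u, hu, hx'u, hQ⟩ := ih
      obtain ⟨w, huw, hw, hQ'⟩ := base hu hz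
      exact ⟨w, hw, hx'u.tail huw, trans_left hQ hQ'⟩
  induction hy using Relation.ReflTransGen.head_induction_on generalizing z with
  | refl => exact ⟨z, self_left y z⟩
  | head hx' _ ih =>
    obtain ⟨u, -, hu, hQ⟩ := strip hx' hz
    obtain ⟨w, hQ'⟩ := ih hu
    exact ⟨w, trans_right hQ hQ'⟩

theorem reflTransGen_subtype {X : Type*} {r : X → X → Prop} {s : Set X}
    (hs : ∀ ⦃x y⦄, x ∈ s → r x y → y ∈ s) {x y : X} (hx : x ∈ s)
    (h : Relation.ReflTransGen r x y) :
    ∃ hy : y ∈ s, Relation.ReflTransGen (fun p q : s => r p q) ⟨x, hx⟩ ⟨y, hy⟩ := by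
  induction h with
  | refl => exact ⟨hx, .refl⟩
  | tail _ hyz ih =>
    obtain ⟨hy, h⟩ := ih
    exact ⟨hs hy hyz, h.tail hyz⟩

end Parallelograms

section Gluing

variable {C : Type u} [Category.{v} C] {J : GrothendieckTopology C}
  {R : Cᵒᵖ ⥤ CommAlgCat.{w} ℚ} {M : Cᵒᵖ ⥤ Type w'}

variable (J R) in
/-- Symmetry of the neighbour relation of `X`, at all stages. -/
def NbrSymmetric (X : Cᵒᵖ ⥤ Type w') : Prop :=
  ∀ ⦃c : C⦄ ⦃x y : X.obj (op c)⦄, Nbr J R X x y → Nbr J R X y x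

namespace Linked

variable {X : Cᵒᵖ ⥤ Type w'} {b c : C} {x y : X.obj (op c)}

theorem restrict (h : Linked J R X x y) (g : b ⟶ c) : Linked J R X (res X g x) (res X g y) :=
  h.lift (res X g) fun _ _ hxy => hxy.restrict J R g

theorem symm (hsym : NbrSymmetric J R X) (h : Linked J R X x y) : Linked J R X y x := by
  induction h with
  | refl => exact .refl
  | tail _ hyz ih => exact .head (hsym hyz) ih

end Linked

theorem NbrInfty.tail {X : Cᵒᵖ ⥤ Type w'} {c : C} {x y z : X.obj (op c)}
    (hxy : NbrInfty J R X x y) (hyz : Nbr J R X y z) : NbrInfty J R X x z := by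
  obtain ⟨S, hS, H⟩ := hxy
  exact ⟨S, hS, fun b g hg => (H g hg).tail (hyz.restrict J R g)⟩

theorem exists_covering_forall {ι : Type*} [Finite ι] {b : C}
    {P : ι → ∀ ⦃a : C⦄, (a ⟶ b) → Prop}
    (h : ∀ i, ∃ S ∈ J b, ∀ ⦃a : C⦄ (f : a ⟶ b), S f → P i f) :
    ∃ S ∈ J b, ∀ ⦃a : C⦄ (f : a ⟶ b), S f → ∀ i, P i f := by
  cases nonempty_fintype ι
  choose S hS H using h
  refine ⟨Finset.univ.inf S, Finset.inf_induction (J.top_mem b)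
    (fun _ hT _ hT' => J.intersection_covering hT hT') fun i _ => hS i, fun a f hf i => H i f ?_⟩
  exact (Finset.inf_le (Finset.mem_univ i) : _ ≤ S i) _ hf

/-- Connections with affine coordinates around every point, after restriction along a covering. -/
def AffineConnection.LocallyAffine (L : AffineConnection J R M) : Prop :=
  ∀ ⦃c : C⦄ (x : M.obj (op c)), ∃ S ∈ J c, ∀ ⦃b : C⦄ (g : b ⟶ c), S g →
    ∃ (V : Type w) (_ : AddCommGroup V) (φ : M.obj (op b) → V), IsAffineCoord L (res M g x) φ

theorem IsFormalManifold.locallyAffine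
    (hR : Presieve.IsSeparated J (R ⋙ forget (CommAlgCat ℚ))) (hKL : FirstOrderKockLawvere R)
    (hman : IsFormalManifold J R M) {L : AffineConnection J R M} (hsymm : L.Symmetric)
    (hflat : L.Flat) : L.LocallyAffine := by
  intro c x
  obtain ⟨S, hS, H⟩ := hman x
  refine ⟨S, hS, fun b g hg => ?_⟩
  obtain ⟨n, χ, ⟨p, hp⟩, hx⟩ := H g hg
  have hat : χ.At (𝟙 b) p (res M g x) := ⟨hp, hx⟩
  exact ⟨Fin n → R.obj (op b), inferInstance, hat.exists_isAffineCoord hR hKL hsymm hflat⟩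

variable {L : AffineConnection J R M} {b : C} {x₀ x y z : M.obj (op b)}

theorem exists_coord_eq_sub_add (L : AffineConnection J R M) (hx : Linked J R M x₀ x)
    (hy : Linked J R M x y) (hz : Linked J R M x z) :
    ∃ w, Linked J R M x₀ w ∧ ∀ ⦃a : C⦄ (h : a ⟶ b) ⦃V : Type w⦄ [AddCommGroup V]
      (φ : M.obj (op a) → V), IsAffineCoord L (res M h x₀) φ →
        φ (res M h w) = φ (res M h y) - φ (res M h x) + φ (res M h z) := by
  have linked_of_nbr ⦃p q : M.obj (op b)⦄ (hp : Linked J R M x₀ p) (hpq : Nbr J R M p q) :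
      Linked J R M x₀ q := hp.tail hpq
  obtain ⟨_, hy⟩ := reflTransGen_subtype (s := {p | Linked J R M x₀ p}) linked_of_nbr hx hy
  obtain ⟨_, hz⟩ := reflTransGen_subtype (s := {p | Linked J R M x₀ p}) linked_of_nbr hx hz
  obtain ⟨⟨w, hw⟩, H⟩ := exists_parallelogram
    (Q := fun y x z w : {p | Linked J R M x₀ p} => ∀ ⦃a : C⦄ (h : a ⟶ b) ⦃V : Type w⦄
      [AddCommGroup V] (φ : M.obj (op a) → V), IsAffineCoord L (res M h x₀) φ →
        φ (res M h w.1) = φ (res M h y.1) - φ (res M h x.1) + φ (res M h z.1))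
    (fun _ _ _ _ _ _ _ _ => by rw [sub_add_cancel])
    (fun _ _ _ _ _ _ _ _ => by rw [sub_self, zero_add])
    (fun x y z hy hz => ⟨⟨L.lam x y z hy hz, y.2.tail (L.nbr_left _ _ _ hy hz)⟩,
      L.nbr_left _ _ _ hy hz, L.nbr_right _ _ _ hy hz, fun a h V _ φ hφ => by
        rw [← L.natural]
        exact hφ.map_lam _ _ (x.2.restrict h)⟩)
    (fun _ _ _ _ _ _ hu hw a h V _ φ hφ => by
      rw [hw h φ hφ, hu h φ hφ]
      abel)
    (fun _ _ _ _ _ _ hu hw a h V _ φ hφ => by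
      rw [hw h φ hφ, hu h φ hφ]
      abel) hy hz
  exact ⟨w, hw, fun a h V _ φ hφ => H h φ hφ⟩

/-- `w` is locally linked to `x` and equal to `∑ i, k i • y i` in affine coordinates around `x`. -/
def IsComb (L : AffineConnection J R M) (x : M.obj (op b)) {m : ℕ} (k : Fin m → ℤ)
    (y : Fin m → M.obj (op b)) (w : M.obj (op b)) : Prop :=
  ∃ S ∈ J b, ∀ ⦃a : C⦄ (h : a ⟶ b), S h → Linked J R M (res M h x) (res M h w) ∧
    ∀ ⦃V : Type w⦄ [AddCommGroup V] (φ : M.obj (op a) → V), IsAffineCoord L (res M h x) φ →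
      φ (res M h w) = ∑ i, k i • φ (res M h (y i))

namespace IsComb

variable {m n : ℕ} {k : Fin m → ℤ} {u : Fin m → M.obj (op b)} {w w' : M.obj (op b)}

theorem restrict (H : IsComb L x k u w) {a : C} (h : a ⟶ b) :
    IsComb L (res M h x) k (fun i => res M h (u i)) (res M h w) := by
  obtain ⟨S, hS, H⟩ := H
  refine ⟨S.pullback h, J.pullback_stable h hS, fun a' l hl => ?_⟩
  simpa only [res_res] using H (l ≫ h) hl

theorem of_locally {S : Sieve b} (hS : S ∈ J b) (H : ∀ ⦃a : C⦄ (h : a ⟶ b), S h →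
    IsComb L (res M h x) k (fun i => res M h (u i)) (res M h w)) : IsComb L x k u w := by
  choose T hT H using H
  refine ⟨Sieve.bind S fun a h hh => T h hh, J.bind_covering hS fun a h hh => hT h hh, ?_⟩
  rintro a _ ⟨a', l, h, hh, hl, rfl⟩
  simpa only [res_res] using H h hh l hl

theorem nbrInfty (H : IsComb L x k u w) : NbrInfty J R M x w := by
  obtain ⟨S, hS, H⟩ := H
  exact ⟨S, hS, fun a h hh => (H h hh).1⟩

theorem unique (hL : L.LocallyAffine) (hM : Presieve.IsSeparated J M) (H : IsComb L x k u w)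
    (H' : IsComb L x k u w') : w = w' := by
  obtain ⟨S, hS, H⟩ := H
  obtain ⟨S', hS', H'⟩ := H'
  obtain ⟨T, hT, hφ⟩ := hL x
  refine eq_of_locally_eq hM
    (J.intersection_covering hT (J.intersection_covering hS hS')) fun a h ⟨hTh, hSh, hSh'⟩ => ?_
  obtain ⟨V, _, φ, hφ⟩ := hφ h hTh
  obtain ⟨hw, coord_w⟩ := H h hSh
  obtain ⟨hw', coord_w'⟩ := H' h hSh'
  exact hφ.inj hw hw' ((coord_w φ hφ).trans (coord_w' φ hφ).symm)

theorem single (L : AffineConnection J R M) (i : Fin m) (hu : NbrInfty J R M x (u i)) :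
    IsComb L x (Pi.single i 1) u (u i) := by
  obtain ⟨S, hS, H⟩ := hu
  refine ⟨S, hS, fun a h hh => ⟨H h hh, fun V _ φ _ => ?_⟩⟩
  simp [Pi.single_apply, ite_smul]

theorem comp {B : Fin m → Fin n → ℤ} {y : Fin n → M.obj (op b)} (hw : IsComb L x k u w)
    (hu : ∀ i, IsComb L x (B i) y (u i)) : IsComb L x (fun j => ∑ i, k i * B i j) y w := by
  obtain ⟨S, hS, hw⟩ := hw
  obtain ⟨T, hT, hu⟩ := exists_covering_forall hu
  refine ⟨S ⊓ T, J.intersection_covering hS hT, fun a h ⟨hSh, hTh⟩ =>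
    ⟨(hw h hSh).1, fun V _ φ hφ => ?_⟩⟩
  rw [(hw h hSh).2 φ hφ]
  simp only [(hu h hTh _).2 φ hφ, Finset.smul_sum, Finset.sum_smul, mul_smul]
  exact Finset.sum_comm

theorem lam (hx : NbrInfty J R M x₀ x) (hy : Nbr J R M x y) (hz : Nbr J R M x z) :
    IsComb L x₀ ![1, -1, 1] ![y, x, z] (L.lam x y z hy hz) := by
  obtain ⟨S, hS, hx⟩ := hx
  refine ⟨S, hS, fun a h hh => ?_⟩
  rw [← L.natural]
  refine ⟨((hx h hh).tail (hy.restrict J R h)).tail (L.nbr_left _ _ _ _ _), fun V _ φ hφ => ?_⟩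
  rw [hφ.map_lam _ _ (hx h hh)]
  simp only [Fin.sum_univ_three, Matrix.cons_val]
  module

end IsComb

theorem exists_isComb_of_linked (L : AffineConnection J R M)
    (hsym : NbrSymmetric J R M) {m : ℕ} {k : Fin m → ℤ} (hk : ∑ i, k i = 1)
    {u : Fin m → M.obj (op b)} (hu : ∀ i, Linked J R M x (u i)) : ∃ w, IsComb L x k u w := by
  obtain ⟨w, hw, coord_w⟩ := sum_one_induction (P := fun k => ∃ w, Linked J R M x w ∧
      ∀ ⦃a : C⦄ (h : a ⟶ b) ⦃V : Type w⦄ [AddCommGroup V] (φ : M.obj (op a) → V),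
        IsAffineCoord L (res M h x) φ → φ (res M h w) = ∑ i, k i • φ (res M h (u i)))
    (fun i => ⟨u i, hu i, fun a h V _ φ _ => by simp [Pi.single_apply, ite_smul]⟩)
    (fun k₁ k₂ k₃ ⟨w₁, hw₁, coord₁⟩ ⟨w₂, hw₂, coord₂⟩ ⟨w₃, hw₃, coord₃⟩ => by
      obtain ⟨w, hw, coord_w⟩ := exists_coord_eq_sub_add L hw₂ ((hw₂.symm hsym).trans hw₁)
        ((hw₂.symm hsym).trans hw₃)
      refine ⟨w, hw, fun a h V _ φ hφ => ?_⟩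
      simp only [coord_w h φ hφ, coord₁ h φ hφ, coord₂ h φ hφ, coord₃ h φ hφ, Pi.add_apply,
        Pi.sub_apply, add_smul, sub_smul, Finset.sum_add_distrib, Finset.sum_sub_distrib]) hk
  exact ⟨w, ⊤, J.top_mem b, fun a h _ => ⟨hw.restrict h, fun V _ φ hφ => coord_w h φ hφ⟩⟩

theorem exists_isComb (hM : Presieve.IsSheaf J M) (hL : L.LocallyAffine)
    (hsym : NbrSymmetric J R M) {m : ℕ} {k : Fin m → ℤ} (hk : ∑ i, k i = 1)
    {u : Fin m → M.obj (op b)} (hu : ∀ i, NbrInfty J R M x (u i)) : ∃ w, IsComb L x k u w := by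
  obtain ⟨S, hS, H⟩ := exists_covering_forall hu
  choose w hw using fun (a : C) (h : a ⟶ b) (hh : S h) =>
    exists_isComb_of_linked L hsym hk (H h hh)
  let family : Presieve.FamilyOfElements M S.arrows := fun a h hh => w a h hh
  have compatible : family.Compatible := by
    rw [Presieve.compatible_iff_sieveCompatible]
    intro a a' h l hh
    refine (hw a' (l ≫ h) (S.downward_closed hh l)).unique hL hM.isSeparated ?_
    simpa only [res_res] using (hw a h hh).restrict l
  obtain ⟨t, ht, -⟩ := hM S hS family compatible
  refine ⟨t, .of_locally hS fun a h hh => ?_⟩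
  rw [show res M h t = w a h hh from ht h hh]
  exact hw a h hh

/-- The affine structure on an `∞`-monad whose combinations are computed in affine coordinates. -/
noncomputable def monadAffineStructure (hM : Presieve.IsSheaf J M) (hL : L.LocallyAffine)
    (hsym : NbrSymmetric J R M) {c : C} (x₀ : M.obj (op c)) :
    AffineStructureOnMonad J R M x₀ :=
  have hex {b : C} (g : b ⟶ c) {n : ℕ} (k : Fin n → ℤ) (hk : ∑ i, k i = 1)
      (y : Fin n → inftyMonad J R M x₀ g) : ∃ w, IsComb L (res M g x₀) k (fun i => (y i).1) w :=
    exists_isComb hM hL hsym hk fun i => (y i).2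
  { str := fun b g =>
      { comb := fun k hk y => ⟨(hex g k hk y).choose, (hex g k hk y).choose_spec.nbrInfty⟩
        comb_single := fun i y h => Subtype.ext <|
          (hex g _ h y).choose_spec.unique hL hM.isSeparated (.single L i (y i).2)
        comb_comb := fun a B y ha hB h => Subtype.ext <|
          ((hex g a ha _).choose_spec.comp fun i => (hex g (B i) (hB i) y).choose_spec).unique hL
            hM.isSeparated (hex g _ h y).choose_spec }
    natural := fun a b h g n k hk y => Subtype.ext <| by
      refine (hex (h ≫ g) k hk _).choose_spec.unique hL hM.isSeparated ?_
      have := (hex g k hk y).choose_spec.restrict h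
      rwa [res_res] at this }

theorem isComb_monadAffineStructure (hM : Presieve.IsSheaf J M) (hL : L.LocallyAffine)
    (hsym : NbrSymmetric J R M) {c : C} (x₀ : M.obj (op c)) (g : b ⟶ c) {n : ℕ} (k : Fin n → ℤ)
    (hk : ∑ i, k i = 1) (y : Fin n → inftyMonad J R M x₀ g) :
    IsComb L (res M g x₀) k (fun i => (y i).1)
      (((monadAffineStructure hM hL hsym x₀).str g).comb k hk y).1 :=
  (exists_isComb hM hL hsym hk fun i => (y i).2).choose_spec

theorem monadAffineStructure_extends (hM : Presieve.IsSheaf J M) (hL : L.LocallyAffine)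
    (hsym : NbrSymmetric J R M) {c : C} (x₀ : M.obj (op c)) :
    (monadAffineStructure hM hL hsym x₀).Extends L := by
  intro b g x y z hy hz
  refine (IsComb.lam x.2 hy hz).unique hL hM.isSeparated ?_
  convert isComb_monadAffineStructure hM hL hsym x₀ g ![1, -1, 1] (by decide) ![y, x, z] using 1
  funext i
  fin_cases i <;> rfl

namespace AffineStructureOnMonad

variable {c : C} {x₀ : M.obj (op c)} {A A' : AffineStructureOnMonad J R M x₀}

theorem res_tern (A : AffineStructureOnMonad J R M x₀) {a : C} (h : a ⟶ b) (g : b ⟶ c)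
    (y x z : inftyMonad J R M x₀ g) :
    inftyMonad.res J R h g ((A.str g).tern y x z) = (A.str (h ≫ g)).tern
      (inftyMonad.res J R h g y) (inftyMonad.res J R h g x) (inftyMonad.res J R h g z) := by
  rw [AffineSpaceStructure.tern, ← A.natural, AffineSpaceStructure.tern]
  congr 1
  funext i
  fin_cases i <;> rfl

theorem Extends.tern_eq_of_linked (hA : A.Extends L) (hA' : A'.Extends L) (g : b ⟶ c)
    (y x z : inftyMonad J R M x₀ g) (hy : Linked J R M x.1 y.1) (hz : Linked J R M x.1 z.1) :
    (A.str g).tern y x z = (A'.str g).tern y x z := by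
  have mem_of_nbr ⦃p q : M.obj (op b)⦄ (hp : p ∈ inftyMonad J R M x₀ g) (hpq : Nbr J R M p q) :
      q ∈ inftyMonad J R M x₀ g := NbrInfty.tail hp hpq
  obtain ⟨_, hy⟩ := reflTransGen_subtype mem_of_nbr x.2 hy
  obtain ⟨_, hz⟩ := reflTransGen_subtype mem_of_nbr x.2 hz
  obtain ⟨w, hw, hw'⟩ := exists_parallelogram
    (Q := fun y x z w => (A.str g).tern y x z = w ∧ (A'.str g).tern y x z = w)
    (fun y x => ⟨AffineSpaceStructure.tern_self_right _ y x,
      AffineSpaceStructure.tern_self_right _ y x⟩)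
    (fun x z => ⟨AffineSpaceStructure.tern_self_left _ x z,
      AffineSpaceStructure.tern_self_left _ x z⟩)
    (fun x y z hy hz => ⟨⟨L.lam x y z hy hz, mem_of_nbr y.2 (L.nbr_left _ _ _ hy hz)⟩,
      L.nbr_left _ _ _ hy hz, L.nbr_right _ _ _ hy hz,
      Subtype.ext (hA g x y z hy hz).symm, Subtype.ext (hA' g x y z hy hz).symm⟩)
    (fun _ _ _ _ _ _ ⟨hu, hu'⟩ ⟨hw, hw'⟩ =>
      ⟨by rw [← hw, ← hu, AffineSpaceStructure.tern_tern_left],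
        by rw [← hw', ← hu', AffineSpaceStructure.tern_tern_left]⟩)
    (fun _ _ _ _ _ _ ⟨hu, hu'⟩ ⟨hw, hw'⟩ =>
      ⟨by rw [← hw, ← hu, AffineSpaceStructure.tern_tern_right],
        by rw [← hw', ← hu', AffineSpaceStructure.tern_tern_right]⟩) hy hz
  exact hw.trans hw'.symm

theorem Extends.unique (hM : Presieve.IsSeparated J M) (hsym : NbrSymmetric J R M)
    (hA : A.Extends L) (hA' : A'.Extends L) : A = A' := by
  have tern_eq ⦃b : C⦄ (g : b ⟶ c) (y x z : inftyMonad J R M x₀ g) :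
      (A.str g).tern y x z = (A'.str g).tern y x z := by
    obtain ⟨S, hS, H⟩ := exists_covering_forall (J := J) fun i => (![y, x, z] i).2
    refine Subtype.ext (eq_of_locally_eq hM hS fun a h hh => ?_)
    have hx := Linked.symm hsym (H h hh 1)
    have key := hA.tern_eq_of_linked hA' (h ≫ g) (inftyMonad.res J R h g y)
      (inftyMonad.res J R h g x) (inftyMonad.res J R h g z) (hx.trans (H h hh 0))
      (hx.trans (H h hh 2))
    rw [← A.res_tern, ← A'.res_tern] at key
    exact congrArg Subtype.val key
  cases A
  cases A'
  congr 1
  funext b g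
  exact AffineSpaceStructure.ext_of_tern (tern_eq g)

end AffineStructureOnMonad

end Gluing

end SDG

theorem theorem3p7_general {C : Type u} [Category.{v} C] (J : GrothendieckTopology C)
    (R : Cᵒᵖ ⥤ CommAlgCat.{w} ℚ)
    (hR : Presieve.IsSeparated J (R ⋙ forget (CommAlgCat ℚ)))
    (hKL : SDG.FirstOrderKockLawvere R)
    (M : Cᵒᵖ ⥤ Type w') (hM : Presieve.IsSheaf J M)
    (hman : SDG.IsFormalManifold J R M)
    (L : SDG.AffineConnection J R M) (hsymm : L.Symmetric) (hflat : L.Flat)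
    {c : C} (x₀ : M.obj (op c)) :
    ∃! A : SDG.AffineStructureOnMonad J R M x₀, A.Extends L := by
  have hsym : SDG.NbrSymmetric J R M := fun _ _ _ => hman.nbr_symm hR hKL
  have hL : L.LocallyAffine := hman.locallyAffine hR hKL hsymm hflat
  have hext := SDG.monadAffineStructure_extends hM hL hsym x₀
  exact ⟨_, hext, fun _ hA => hA.unique hM.isSeparated hsym hext⟩

theorem theorem3p7 {C : Type u} [Category.{v} C] (J : GrothendieckTopology C)
    (R : Cᵒᵖ ⥤ CommAlgCat.{w} ℚ)
    (hR : Presieve.IsSheaf J (R ⋙ forget (CommAlgCat ℚ)))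
    (hKL : SDG.KockLawvere R)
    (M : Cᵒᵖ ⥤ Type w') (hM : Presieve.IsSheaf J M)
    (hman : SDG.IsFormalManifold J R M)
    (L : SDG.AffineConnection J R M) (hsymm : L.Symmetric) (hflat : L.Flat)
    {c : C} (x₀ : M.obj (op c)) :
    ∃! A : SDG.AffineStructureOnMonad J R M x₀, A.Extends L :=
  theorem3p7_general J R hR.isSeparated hKL.firstOrder M hM hman L hsymm hflat x₀
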